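/- Let $V$ be a finite nonempty set. Let $\mathbb S^V$ be the space of real symmetric $V\times V$ matrices with the trace inner product $\langle X,Y\rangle=\operatorname{tr}(XY^{\mathsf T})$, and let $\mathbb S^V_{\ge 0}$, $\mathbb S^V_+$, $\mathcal C_V$ denote the cones of entrywise nonnegative, positive semidefinite and copositive matrices in $\mathbb S^V$. The dual cone of $\mathbb K\subseteq\mathbb S^V$ is $\mathbb K^*=\{Y\in\mathbb S^V:\langle X,Y\rangle\ge 0\ \forall X\in\mathbb K\}$, and $\mathcal C_V^*$ is the cone of completely positive matrices; write $X\succeq_{\mathbb K}Y$ for $X-Y\in\mathbb K$. For $h\in\mathbb R^V$ put $\mathcal D_h(X)=\operatorname{Diag}(h)X\operatorname{Diag}(h)$; a set $\mathbb M\subseteq\mathbb S^V$ is diagonally scaling-invariant if $\mathcal D_h(\mathbb M)\subseteq\mathbb M$ for all $h\in\mathbb R^V_+$. Let $\lambda_{\max}$, $\lambda_{\min}$ be the largest and smallest eigenvalue, $\bar e$ the all-ones vector, $\sqrt w$ the componentwise square root, and $[P]$ the Iverson bracket, where $[P]\,t$ is $0$ if $P$ fails, even if $t$ is undefined. (I)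 Let $\mathbb M\subseteq\mathbb S^V$ be a diagonally scaling-invariant closed convex cone such that (i) $\operatorname{diag}(\mathbb M)\subseteq\mathbb R^V_+$; (ii) if $X\in\mathbb M$ and $X_{ii}=0$, then $Xe_i=0$; (iii) $\{X\in\mathbb M:\operatorname{tr}X=1\}$ is compact; and $\operatorname{Diag}(\mathbb R^V_+)\subseteq\mathbb M$. Suppose that $\mathcal D_h(\mathbb M)\subseteq\mathbb M$ for every $h\in\mathbb R^V$, or that $\mathbb M\subseteq\mathbb S^V_{\ge0}$. Then for every $w\in\mathbb R^V_+$ $$\max\{\lambda_{\max}(B): B\in\mathbb M,\ \operatorname{diag}(B)=w\}=\max\{\sqrt w^{\mathsf T}X\sqrt w:\ \operatorname{tr}(X)=1,\ X\in\mathbb M\},$$ and both maxima are attained. (II) For $E^+,E^-\subseteq\binom V2$ let $\mathbb A_{E^+,E^-}=\{X\in\mathbb S^V: X_{ij}\ge0\ \forall ij\in E^+,\ X_{ij}\le0\ \forall ij\in E^-\}$, and for $\mathbb A\subseteq\mathbb S^V$ let $\mathbb A^{\diamond}=\operatorname{Im}(\operatorname{Diag})-\mathbb A^*$. For $\mathbb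 K\subseteq\mathbb S^V$ let $\operatorname{Schur}(\mathbb K)$ be the set of matrices $\begin{bmatrix}x_0&x^{\mathsf T}\\x&X\end{bmatrix}\in\mathbb S^{\{0\}\cup V}$ with $X\in\mathbb K$, $x_0\ge0$, $x_0X\succeq_{\mathbb K}xx^{\mathsf T}$; let $\operatorname{TH}(\mathbb A,\widehat{\mathbb K})$ be the set of vectors $\operatorname{diag}(\hat X[V])$, where $\hat X\in\widehat{\mathbb K}\subseteq\mathbb S^{\{0\}\cup V}$, $\hat X_{00}=1$, $\hat Xe_0=\operatorname{diag}(\hat X)$, $\hat X[V]\in\mathbb A$. With $\operatorname{abl}(C)=\{y\in\mathbb R^V_+: y^{\mathsf T}x\le1\ \forall x\in C\}$, define $$\theta(\mathbb A,\mathbb K;w)=\sup\{w^{\mathsf T}y: y\in\operatorname{abl}(\operatorname{cl}(\operatorname{TH}(\mathbb A^\diamond,\operatorname{Schur}(\mathbb K^*))))\}.$$ For a graph $H=(V,F)$, with $\overline F=\binom V2\setminus F$, put $\theta(H;w)=\theta(\mathbb A_{F,F},\mathbb S^V_+;w)$, $\theta'(H;w)=\theta(\mathbb A_{F\cup\overline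 F,F},\mathbb S^V_+;w)$, and $\alpha(H;w)=\max\{w^{\mathsf T}x: x\in\operatorname{STAB}(H)\}$, where $\operatorname{STAB}(H)$ is the convex hull of the incidence vectors of the stable sets of $H$. Then for every graph $G=(V,E)$, with complement $\overline G$, $$\theta(\overline G;\bar e)=\max\Big\{1-[A\ne0]\tfrac{\lambda_{\max}(A)}{\lambda_{\min}(A)}: A\in\mathbb A_{E,E}^*\Big\},$$ $$\theta'(\overline G;\bar e)=\max\Big\{1-[A\ne0]\tfrac{\lambda_{\max}(A)}{\lambda_{\min}(A)}: A\in\mathbb A_{E,\emptyset}^*\Big\},$$ $$\alpha(\overline G;\bar e)=\max\Big\{1-[\mu\ne0]\tfrac{\lambda_{\max}(A)}{\mu}: A\in\mathbb A_{E,E}^*,\ \mu\le0,\ A\succeq_{\mathcal C_V^*}\mu I\Big\}.$$ All the optimization problems here, including those that define $\theta(\overline G;\bar e)$, $\theta'(\overline G;\bar e)$ and $\alpha(\overline G;\bar e)$, have optimal solutions. -/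

import Mathlib

open Matrix

namespace HoffmanTheta

noncomputable section

variable {V : Type*}

/-- Iverson bracket: `1` if `P` holds, `0` otherwise. -/
def iverson (P : Prop) : ℝ :=
  open Classical in if P then 1 else 0

/-- The space of symmetric real `V × V` matrices, as a set. -/
def Sym (V : Type*) : Set (Matrix V V ℝ) := {X | X.IsSymm}

/-- Entrywise nonnegative symmetric matrices. -/
def SymNonneg (V : Type*) : Set (Matrix V V ℝ) := {X | X.IsSymm ∧ ∀ i j, 0 ≤ X i j}

/-- Positive semidefinite matrices (symmetry is part of `Matrix.PosSemidef`). -/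
def Psd (V : Type*) : Set (Matrix V V ℝ) := {X | X.PosSemidef}

/-- Copositive matrices. -/
def Copositive (V : Type*) [Fintype V] : Set (Matrix V V ℝ) :=
  {X | X.IsSymm ∧ ∀ h : V → ℝ, (∀ i, 0 ≤ h i) → 0 ≤ h ⬝ᵥ X *ᵥ h}

/-- The dual cone, inside the space of symmetric matrices with the trace inner product. -/
def dualCone [Fintype V] (K : Set (Matrix V V ℝ)) : Set (Matrix V V ℝ) :=
  {Y | Y.IsSymm ∧ ∀ X ∈ K, 0 ≤ (X * Yᵀ).trace}

/-- Completely positive matrices: the dual cone of the copositive cone. -/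
def ComplPositive (V : Type*) [Fintype V] : Set (Matrix V V ℝ) :=
  dualCone (Copositive V)

/-- `X ⪰_K Y`. -/
def ConeGE (K : Set (Matrix V V ℝ)) (X Y : Matrix V V ℝ) : Prop := X - Y ∈ K

/-- The largest eigenvalue of a symmetric matrix (its spectrum is the set of its eigenvalues,
finite, and nonempty when `V` is). -/
def lambdaMax [Fintype V] [DecidableEq V] (X : Matrix V V ℝ) : ℝ := sSup (spectrum ℝ X)

/-- The smallest eigenvalue of a symmetric matrix. -/
def lambdaMin [Fintype V] [DecidableEq V] (X : Matrix V V ℝ) : ℝ := sInf (spectrum ℝ X)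

/-- The diagonal scaling map `X ↦ Diag(h) X Diag(h)`. -/
def diagScale [Fintype V] [DecidableEq V] (h : V → ℝ) (X : Matrix V V ℝ) : Matrix V V ℝ :=
  diagonal h * X * diagonal h

/-- Invariance under the diagonal scaling maps of nonnegative vectors. -/
def DiagScalingInvariant [Fintype V] [DecidableEq V] (M : Set (Matrix V V ℝ)) : Prop :=
  ∀ h : V → ℝ, (∀ i, 0 ≤ h i) → ∀ X ∈ M, diagScale h X ∈ M

/-- The cone of symmetric matrices that are nonnegative on `E⁺` and nonpositive on `E⁻`. Sets of
unordered pairs of distinct elements of `V` are represented by simple graphs on `V`. -/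
def polyAdjCone (Ep Em : SimpleGraph V) : Set (Matrix V V ℝ) :=
  {X | X.IsSymm ∧ (∀ i j, Ep.Adj i j → 0 ≤ X i j) ∧ (∀ i j, Em.Adj i j → X i j ≤ 0)}

/-- The adjacency dual `Image(Diag) - A*`. -/
def adjDual [Fintype V] [DecidableEq V] (A : Set (Matrix V V ℝ)) : Set (Matrix V V ℝ) :=
  {X | ∃ d : V → ℝ, ∃ Y ∈ dualCone A, X = diagonal d - Y}

/-- The lifted theta body. The index set `{0} ∪ V` is `Option V`, with `none` as `0`. -/
def liftedGenTH (A : Set (Matrix V V ℝ)) (K : Set (Matrix (Option V) (Option V) ℝ)) :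
    Set (Matrix (Option V) (Option V) ℝ) :=
  {X | X ∈ K ∧ X none none = 1 ∧ (∀ i, X i none = X i i) ∧ X.submatrix some some ∈ A}

/-- The theta body `TH(A, K)`. -/
def genTH (A : Set (Matrix V V ℝ)) (K : Set (Matrix (Option V) (Option V) ℝ)) :
    Set (V → ℝ) :=
  (fun X => (X.submatrix some some).diag) '' liftedGenTH A K

/-- The Schur lifting of `K`: block matrices `[x₀ xᵀ; x X]` with `X ∈ K`, `x₀ ≥ 0` and
`x₀ X ⪰_K x xᵀ`. -/
def schurLift (K : Set (Matrix V V ℝ)) : Set (Matrix (Option V) (Option V) ℝ) :=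
  {X | X.IsSymm ∧ X.submatrix some some ∈ K ∧ 0 ≤ X none none ∧
    ConeGE K (X none none • X.submatrix some some)
      (vecMulVec (fun i => X (some i) none) (fun i => X (some i) none))}

/-- The antiblocker. -/
def antiblocker [Fintype V] (C : Set (V → ℝ)) : Set (V → ℝ) :=
  {y | (∀ i, 0 ≤ y i) ∧ ∀ x ∈ C, y ⬝ᵥ x ≤ 1}

/-- The values of the linear function `x ↦ ⟨w, x⟩` on `C`. -/
def linValues [Fintype V] (C : Set (V → ℝ)) (w : V → ℝ) : Set ℝ := (fun x => w ⬝ᵥ x) '' C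

/-- The support function. -/
def suppFun [Fintype V] (C : Set (V → ℝ)) (w : V → ℝ) : ℝ := sSup (linValues C w)

/-- The feasible region of the problem that defines `θ(A, K; w)`. -/
def thetaRegion [Fintype V] [DecidableEq V] (A K : Set (Matrix V V ℝ)) : Set (V → ℝ) :=
  antiblocker (closure (genTH (adjDual A) (schurLift (dualCone K))))

/-- The parameter `θ(A, K; w)`. -/
def theta [Fintype V] [DecidableEq V] (A K : Set (Matrix V V ℝ)) (w : V → ℝ) : ℝ :=
  suppFun (thetaRegion A K) w

/-- The cone that defines the Lovász theta function: zero entries on the edges. -/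
def coneTheta (G : SimpleGraph V) : Set (Matrix V V ℝ) := polyAdjCone G G

/-- The cone that defines `θ'`: zero entries on the edges, nonnegative on the non-edges. -/
def coneTheta' (G : SimpleGraph V) : Set (Matrix V V ℝ) := polyAdjCone (G ⊔ Gᶜ) G

/-- The weighted Lovász theta number `θ(G; w)`. -/
def lovaszTheta [Fintype V] [DecidableEq V] (G : SimpleGraph V) (w : V → ℝ) : ℝ :=
  theta (coneTheta G) (Psd V) w

/-- The weighted variant `θ'(G; w)`. -/
def lovaszTheta' [Fintype V] [DecidableEq V] (G : SimpleGraph V) (w : V → ℝ) : ℝ :=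
  theta (coneTheta' G) (Psd V) w

/-- The stable set polytope. -/
def STAB (G : SimpleGraph V) : Set (V → ℝ) :=
  convexHull ℝ {x | ∃ S : Set V, G.IsIndepSet S ∧ x = S.indicator 1}

/-- The weighted stability number. -/
def alpha [Fintype V] (G : SimpleGraph V) (w : V → ℝ) : ℝ := suppFun (STAB G) w

end

end HoffmanTheta

namespace HoffmanTheta

section Quadratic

variable {V : Type*} [Fintype V]

theorem trace_mul_transpose_eq_sum (X Y : Matrix V V ℝ) :
    (X * Yᵀ).trace = ∑ i, ∑ j, X i j * Y i j := by
  simp [Matrix.trace, Matrix.mul_apply]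

theorem quadForm_eq_sum (X : Matrix V V ℝ) (x : V → ℝ) :
    x ⬝ᵥ X *ᵥ x = ∑ i, ∑ j, x i * X i j * x j := by
  simp [dotProduct, Matrix.mulVec, Finset.mul_sum, mul_assoc]

theorem posSemidef_iff_quadForm {X : Matrix V V ℝ} :
    X.PosSemidef ↔ X.IsSymm ∧ ∀ x : V → ℝ, 0 ≤ x ⬝ᵥ X *ᵥ x := by
  simp [posSemidef_iff_dotProduct_mulVec, Matrix.IsHermitian, Matrix.IsSymm]

theorem isHermitian_of_isSymm {W : Type*} {X : Matrix W W ℝ} (hX : X.IsSymm) : X.IsHermitian := by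
  simpa [Matrix.IsHermitian, Matrix.IsSymm] using hX

/-- The trace pairing of two positive semidefinite matrices is nonnegative. -/
theorem trace_mul_transpose_nonneg {X Y : Matrix V V ℝ} (hX : X.PosSemidef) (hY : Y.PosSemidef) :
    0 ≤ (X * Yᵀ).trace := by
  have h := (posSemidef_iff_quadForm.1 (hX.hadamard hY)).2 1
  rw [quadForm_eq_sum] at h
  simpa [trace_mul_transpose_eq_sum] using h

theorem quadForm_add (X Y : Matrix V V ℝ) (x : V → ℝ) :
    x ⬝ᵥ (X + Y) *ᵥ x = x ⬝ᵥ X *ᵥ x + x ⬝ᵥ Y *ᵥ x := by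
  rw [Matrix.add_mulVec, dotProduct_add]

theorem quadForm_smul (c : ℝ) (X : Matrix V V ℝ) (x : V → ℝ) :
    x ⬝ᵥ (c • X) *ᵥ x = c * (x ⬝ᵥ X *ᵥ x) := by
  rw [Matrix.smul_mulVec, dotProduct_smul, smul_eq_mul]

variable [DecidableEq V]

theorem quadForm_one (x : V → ℝ) : x ⬝ᵥ (1 : Matrix V V ℝ) *ᵥ x = x ⬝ᵥ x := by
  rw [Matrix.one_mulVec]

theorem diagScale_apply (h : V → ℝ) (X : Matrix V V ℝ) (i j : V) :
    diagScale h X i j = h i * X i j * h j := by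
  simp [diagScale, Matrix.mul_diagonal, Matrix.diagonal_mul]

theorem quadForm_diagScale (h x : V → ℝ) (X : Matrix V V ℝ) :
    x ⬝ᵥ diagScale h X *ᵥ x = (fun i => h i * x i) ⬝ᵥ X *ᵥ (fun i => h i * x i) := by
  simp only [quadForm_eq_sum, diagScale_apply]
  exact Finset.sum_congr rfl fun i _ => Finset.sum_congr rfl fun j _ => by ring

theorem isSymm_diagScale {h : V → ℝ} {X : Matrix V V ℝ} (hX : X.IsSymm) :
    (diagScale h X).IsSymm := by
  ext i j
  simp only [Matrix.transpose_apply, diagScale_apply, hX.apply i j]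
  ring

end Quadratic

section Spectral

variable {V : Type*} [Fintype V] [DecidableEq V] {X : Matrix V V ℝ}

theorem exists_unit_eigenvector (hX : X.IsSymm) {μ : ℝ} (hμ : μ ∈ spectrum ℝ X) :
    ∃ v : V → ℝ, v ⬝ᵥ v = 1 ∧ X *ᵥ v = μ • v := by
  have hH := isHermitian_of_isSymm hX
  rw [hH.spectrum_real_eq_range_eigenvalues] at hμ
  obtain ⟨j, rfl⟩ := hμ
  refine ⟨(hH.eigenvectorBasis j).ofLp, ?_, hH.mulVec_eigenvectorBasis j⟩
  have h := hH.eigenvectorBasis.orthonormal.1 j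
  have h2 : inner ℝ (hH.eigenvectorBasis j) (hH.eigenvectorBasis j) = 1 := by
    rw [real_inner_self_eq_norm_sq, h, one_pow]
  rw [EuclideanSpace.inner_eq_star_dotProduct] at h2
  simpa using h2

theorem posSemidef_smul_one_sub (hX : X.IsSymm) {c : ℝ} (hc : c ∈ upperBounds (spectrum ℝ X)) :
    (c • (1 : Matrix V V ℝ) - X).PosSemidef := by
  have hs : (c • (1 : Matrix V V ℝ) - X).IsSymm := (Matrix.isSymm_one.smul c).sub hX
  refine posSemidef_iff_isHermitian_and_spectrum_nonneg.2 ⟨isHermitian_of_isSymm hs, ?_⟩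
  have h := spectrum.singleton_sub_eq (R := ℝ) X c
  rw [Algebra.algebraMap_eq_smul_one] at h
  rw [← h]
  rintro _ ⟨a, rfl, b, hb, rfl⟩
  exact sub_nonneg.2 (hc hb)

theorem posSemidef_sub_smul_one (hX : X.IsSymm) {c : ℝ} (hc : c ∈ lowerBounds (spectrum ℝ X)) :
    (X - c • (1 : Matrix V V ℝ)).PosSemidef := by
  have hs : (X - c • (1 : Matrix V V ℝ)).IsSymm := hX.sub (Matrix.isSymm_one.smul c)
  refine posSemidef_iff_isHermitian_and_spectrum_nonneg.2 ⟨isHermitian_of_isSymm hs, ?_⟩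
  have h := spectrum.sub_singleton_eq (R := ℝ) X c
  rw [Algebra.algebraMap_eq_smul_one] at h
  rw [← h]
  rintro _ ⟨b, hb, a, rfl, rfl⟩
  exact sub_nonneg.2 (hc hb)

variable [Nonempty V]

theorem spectrum_nonempty_of_isSymm (hX : X.IsSymm) : (spectrum ℝ X).Nonempty := by
  rw [(isHermitian_of_isSymm hX).spectrum_real_eq_range_eigenvalues]
  exact Set.range_nonempty _

theorem isGreatest_lambdaMax (hX : X.IsSymm) : IsGreatest (spectrum ℝ X) (lambdaMax X) :=
  ⟨(spectrum_nonempty_of_isSymm hX).csSup_mem Matrix.finite_real_spectrum,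
    fun _ h => le_csSup Matrix.finite_real_spectrum.bddAbove h⟩

theorem isLeast_lambdaMin (hX : X.IsSymm) : IsLeast (spectrum ℝ X) (lambdaMin X) :=
  ⟨(spectrum_nonempty_of_isSymm hX).csInf_mem Matrix.finite_real_spectrum,
    fun _ h => csInf_le Matrix.finite_real_spectrum.bddBelow h⟩

theorem quadForm_le_lambdaMax (hX : X.IsSymm) (v : V → ℝ) :
    v ⬝ᵥ X *ᵥ v ≤ lambdaMax X * (v ⬝ᵥ v) := by
  have h := (posSemidef_iff_quadForm.1
    (posSemidef_smul_one_sub hX (isGreatest_lambdaMax hX).2)).2 v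
  rw [Matrix.sub_mulVec, dotProduct_sub, quadForm_smul, quadForm_one] at h
  linarith

theorem exists_eigenvector_lambdaMax (hX : X.IsSymm) :
    ∃ v : V → ℝ, v ⬝ᵥ v = 1 ∧ X *ᵥ v = lambdaMax X • v :=
  exists_unit_eigenvector hX (isGreatest_lambdaMax hX).1

theorem exists_unit_quadForm_eq_lambdaMax (hX : X.IsSymm) :
    ∃ v : V → ℝ, v ⬝ᵥ v = 1 ∧ v ⬝ᵥ X *ᵥ v = lambdaMax X := by
  obtain ⟨v, hv, h⟩ := exists_eigenvector_lambdaMax hX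
  exact ⟨v, hv, by rw [h, dotProduct_smul, hv, smul_eq_mul, mul_one]⟩

/-- The largest eigenvalue commutes with increasing affine maps. -/
theorem lambdaMax_smul_add_smul_one (hX : X.IsSymm) {a : ℝ} (ha : 0 ≤ a) (b : ℝ) :
    lambdaMax (a • X + b • (1 : Matrix V V ℝ)) = a * lambdaMax X + b := by
  have hs : (a • X + b • (1 : Matrix V V ℝ)).IsSymm := (hX.smul a).add (Matrix.isSymm_one.smul b)
  have key : ∀ v : V → ℝ, v ⬝ᵥ v = 1 →
      v ⬝ᵥ (a • X + b • (1 : Matrix V V ℝ)) *ᵥ v = a * (v ⬝ᵥ X *ᵥ v) + b := fun v hv => by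
    rw [quadForm_add, quadForm_smul, quadForm_smul, quadForm_one, hv, mul_one]
  apply le_antisymm
  · obtain ⟨v, hv, h⟩ := exists_unit_quadForm_eq_lambdaMax hs
    rw [← h, key v hv]
    have := quadForm_le_lambdaMax hX v
    rw [hv, mul_one] at this
    gcongr
  · obtain ⟨v, hv, h⟩ := exists_unit_quadForm_eq_lambdaMax hX
    have := quadForm_le_lambdaMax hs v
    rwa [key v hv, hv, mul_one, h] at this

end Spectral

section ScalingInvariantCone

variable {V : Type*} [Fintype V] [DecidableEq V]

/-- A unit vector attaining the largest eigenvalue of an entrywise nonnegative matrix may be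
replaced by its absolute value. -/
theorem lambdaMax_le_quadForm_abs {B : Matrix V V ℝ} (hB : B ∈ SymNonneg V) {v : V → ℝ}
    (h : v ⬝ᵥ B *ᵥ v = lambdaMax B) :
    lambdaMax B ≤ (fun i => |v i|) ⬝ᵥ B *ᵥ (fun i => |v i|) := by
  rw [← h, quadForm_eq_sum, quadForm_eq_sum]
  refine Finset.sum_le_sum fun i _ => Finset.sum_le_sum fun j _ => ?_
  calc v i * B i j * v j ≤ |v i * B i j * v j| := le_abs_self _
    _ = |v i| * B i j * |v j| := by rw [abs_mul, abs_mul, abs_of_nonneg (hB.2 i j)]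

variable [Nonempty V]

/-- The largest eigenvalue over the matrices of a scaling-invariant cone with a given diagonal,
as a linear optimization problem over the matrices of trace one of the cone. -/
theorem exists_isGreatest_lambdaMax_quadForm (M : ConvexCone ℝ (Matrix V V ℝ))
    (hsym : (M : Set (Matrix V V ℝ)) ⊆ Sym V)
    (hscale : DiagScalingInvariant (M : Set (Matrix V V ℝ)))
    (hdiag : ∀ X ∈ M, ∀ i, 0 ≤ X i i)
    (hzero : ∀ X ∈ M, ∀ i, X i i = 0 → ∀ j, X j i = 0)
    (hcomp : IsCompact {X : Matrix V V ℝ | X ∈ M ∧ X.trace = 1})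
    (hDiag : ∀ d : V → ℝ, (∀ i, 0 ≤ d i) → Matrix.diagonal d ∈ M)
    (hor : (∀ h : V → ℝ, ∀ X ∈ M, diagScale h X ∈ M) ∨
      (M : Set (Matrix V V ℝ)) ⊆ SymNonneg V)
    (w : V → ℝ) (hw : ∀ i, 0 ≤ w i) :
    ∃ m : ℝ,
      IsGreatest {r : ℝ | ∃ B ∈ M, B.diag = w ∧ r = lambdaMax B} m ∧
      IsGreatest {r : ℝ | ∃ X ∈ M, X.trace = 1 ∧
        r = (fun i => √(w i)) ⬝ᵥ X *ᵥ (fun i => √(w i))} m := by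
  set s : V → ℝ := fun i => √(w i) with hs
  have hss : ∀ i, s i * s i = w i := fun i => Real.mul_self_sqrt (hw i)
  let k : V := Classical.arbitrary V
  have hk : Matrix.diagonal (Pi.single k (1 : ℝ)) ∈ M := hDiag _ fun i => by
    by_cases h : i = k
    · subst h; simp
    · simp [h]
  have hktr : (Matrix.diagonal (Pi.single k (1 : ℝ)) : Matrix V V ℝ).trace = 1 := by
    simp [Matrix.trace_diagonal]
  have hcont : Continuous fun X : Matrix V V ℝ => s ⬝ᵥ X *ᵥ s := by
    simp only [quadForm_eq_sum]; fun_prop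
  obtain ⟨X₀, ⟨hX₀M, hX₀tr⟩, hX₀max⟩ := hcomp.exists_isMaxOn
    ⟨_, hk, hktr⟩ hcont.continuousOn
  set m := s ⬝ᵥ X₀ *ᵥ s with hm
  have hmax : ∀ X ∈ M, X.trace = 1 → s ⬝ᵥ X *ᵥ s ≤ m := fun X hX htr => hX₀max ⟨hX, htr⟩
  have hm0 : 0 ≤ m := by
    refine le_trans ?_ (hmax _ hk hktr)
    simp [quadForm_eq_sum, Matrix.diagonal_apply, Pi.single_apply, hss, hw]
  have hmtr : ∀ X ∈ M, s ⬝ᵥ X *ᵥ s ≤ m * X.trace := by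
    intro X hX
    have htr : 0 ≤ X.trace := Finset.sum_nonneg fun i _ => hdiag X hX i
    rcases htr.eq_or_lt with h0 | hpos
    · have hX0 : X = 0 := by
        have h := (Finset.sum_eq_zero_iff_of_nonneg fun i _ => hdiag X hX i).1 h0.symm
        ext i j
        exact hzero X hX j (h j (Finset.mem_univ j)) i
      simp [hX0]
    · have h := hmax (X.trace⁻¹ • X) (M.smul_mem (inv_pos.2 hpos) hX)
        (by rw [Matrix.trace_smul, smul_eq_mul, inv_mul_cancel₀ hpos.ne'])
      rw [quadForm_smul] at h
      rwa [inv_mul_le_iff₀ hpos, mul_comm] at h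
  have hupper : ∀ B ∈ M, B.diag = w → lambdaMax B ≤ m := by
    intro B hB hBw
    have hBs : B.IsSymm := hsym hB
    obtain ⟨v, hv1, hvM, hvle⟩ : ∃ v : V → ℝ, v ⬝ᵥ v = 1 ∧
        ((∀ i, 0 ≤ v i) ∨ ∀ h : V → ℝ, ∀ X ∈ M, diagScale h X ∈ M) ∧
        lambdaMax B ≤ v ⬝ᵥ B *ᵥ v := by
      obtain ⟨v, hv, h⟩ := exists_unit_quadForm_eq_lambdaMax hBs
      rcases hor with hor | hor
      · exact ⟨v, hv, Or.inr hor, h.ge⟩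
      · refine ⟨fun i => |v i|, ?_, Or.inl fun i => abs_nonneg _,
          lambdaMax_le_quadForm_abs (hor hB) h⟩
        rw [← hv]
        exact Finset.sum_congr rfl fun i _ => abs_mul_abs_self _
    set h : V → ℝ := fun i => v i / s i with hh
    have hXM : diagScale h B ∈ M := by
      rcases hvM with hv | hall
      · exact hscale h (fun i => div_nonneg (hv i) (Real.sqrt_nonneg _)) B hB
      · exact hall h B hB
    have hBii : ∀ i, B i i = w i := fun i => congrFun hBw i
    have hBz : ∀ i, s i = 0 → ∀ j, B j i = 0 := fun i hi j =>
      hzero B hB i (by rw [hBii, ← hss, hi, mul_zero]) j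
    have hBz' : ∀ i, s i = 0 → ∀ j, B i j = 0 := fun i hi j => by
      rw [← hBs.apply]; exact hBz i hi j
    have hq : s ⬝ᵥ diagScale h B *ᵥ s = v ⬝ᵥ B *ᵥ v := by
      simp only [quadForm_eq_sum, diagScale_apply, hh]
      refine Finset.sum_congr rfl fun i _ => Finset.sum_congr rfl fun j _ => ?_
      by_cases hi : s i = 0
      · simp [hBz' i hi]
      by_cases hj : s j = 0
      · simp [hBz j hj]
      field_simp
    have htr : (diagScale h B).trace ≤ 1 := by
      rw [← hv1]
      refine Finset.sum_le_sum fun i _ => ?_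
      simp only [Matrix.diag_apply, diagScale_apply, hh, hBii, ← hss]
      by_cases hi : s i = 0
      · simp [hi, mul_self_nonneg]
      · exact le_of_eq (by field_simp)
    calc lambdaMax B ≤ v ⬝ᵥ B *ᵥ v := hvle
      _ = s ⬝ᵥ diagScale h B *ᵥ s := hq.symm
      _ ≤ m * (diagScale h B).trace := hmtr _ hXM
      _ ≤ m * 1 := by gcongr
      _ = m := mul_one m
  refine ⟨m, ⟨?_, ?_⟩, ⟨X₀, hX₀M, hX₀tr, rfl⟩, ?_⟩
  · have hX₀d := hdiag X₀ hX₀M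
    set t : V → ℝ := fun i => √(X₀ i i) with ht
    have htt : ∀ i, t i * t i = X₀ i i := fun i => Real.mul_self_sqrt (hX₀d i)
    have hz : ∀ i, t i = 0 → ∀ j, X₀ j i = 0 := fun i hi j =>
      hzero X₀ hX₀M i (by rw [← htt, hi, mul_zero]) j
    have hz' : ∀ i, t i = 0 → ∀ j, X₀ i j = 0 := fun i hi j => by
      rw [← (hsym hX₀M : X₀.IsSymm).apply]; exact hz i hi j
    set d : V → ℝ := fun i => if t i = 0 then w i else 0 with hd
    set B := diagScale (fun i => s i / t i) X₀ + Matrix.diagonal d with hB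
    have hBM : B ∈ M := M.add_mem
      (hscale _ (fun i => div_nonneg (Real.sqrt_nonneg _) (Real.sqrt_nonneg _)) X₀ hX₀M)
      (hDiag d fun i => by simp only [hd]; split_ifs <;> simp [hw])
    have hBw : B.diag = w := by
      ext i
      simp only [hB, Matrix.diag_apply, Matrix.add_apply, diagScale_apply,
        Matrix.diagonal_apply_eq, hd]
      split_ifs with hi
      · simp [hi]
      · rw [← htt, ← hss]; field_simp; ring
    refine ⟨B, hBM, hBw, le_antisymm ?_ (hupper B hBM hBw)⟩
    have h := quadForm_le_lambdaMax (hsym hBM : B.IsSymm) t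
    have ht1 : t ⬝ᵥ t = 1 := by
      rw [← hX₀tr]; exact Finset.sum_congr rfl fun i _ => htt i
    have hdz : t ⬝ᵥ Matrix.diagonal d *ᵥ t = 0 := by
      simp only [Matrix.mulVec_diagonal, dotProduct]
      refine Finset.sum_eq_zero fun i _ => ?_
      simp only [hd]
      split_ifs with hi <;> simp [hi]
    have hq : t ⬝ᵥ B *ᵥ t = m := by
      rw [hB, quadForm_add, hdz, add_zero, hm]
      simp only [quadForm_eq_sum, diagScale_apply]
      refine Finset.sum_congr rfl fun i _ => Finset.sum_congr rfl fun j _ => ?_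
      by_cases hi : t i = 0
      · simp [hz' i hi]
      by_cases hj : t j = 0
      · simp [hz j hj]
      field_simp
    rwa [ht1, mul_one, hq] at h
  · rintro r ⟨B, hB, hBw, rfl⟩
    exact hupper B hB hBw
  · rintro r ⟨X, hX, htr, rfl⟩
    exact hmax X hX htr

end ScalingInvariantCone

section Cones

variable {V : Type*}

/-- The cone `polyAdjCone P Q` as a convex cone. -/
def polyAdjConvexCone (P Q : SimpleGraph V) : ConvexCone ℝ (Matrix V V ℝ) where
  carrier := polyAdjCone P Q
  smul_mem' c hc _ hX := ⟨hX.1.smul c, fun i j h => mul_nonneg hc.le (hX.2.1 i j h),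
    fun i j h => mul_nonpos_of_nonneg_of_nonpos hc.le (hX.2.2 i j h)⟩
  add_mem' _ hX _ hY := ⟨hX.1.add hY.1, fun i j h => add_nonneg (hX.2.1 i j h) (hY.2.1 i j h),
    fun i j h => add_nonpos (hX.2.2 i j h) (hY.2.2 i j h)⟩

/-- The positive semidefinite matrices as a convex cone. -/
def psdConvexCone (V : Type*) : ConvexCone ℝ (Matrix V V ℝ) where
  carrier := Psd V
  smul_mem' _ hc _ hX := Matrix.PosSemidef.smul hX hc.le
  add_mem' _ hX _ hY := Matrix.PosSemidef.add hX hY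

theorem isClosed_isSymm : IsClosed {X : Matrix V V ℝ | X.IsSymm} :=
  isClosed_eq continuous_id.matrix_transpose continuous_id

theorem isClosed_polyAdjCone (P Q : SimpleGraph V) : IsClosed (polyAdjCone P Q) := by
  have h : polyAdjCone P Q = {X : Matrix V V ℝ | X.IsSymm} ∩
      ((⋂ i, ⋂ j, ⋂ _ : P.Adj i j, {X : Matrix V V ℝ | 0 ≤ X i j}) ∩
        ⋂ i, ⋂ j, ⋂ _ : Q.Adj i j, {X : Matrix V V ℝ | X i j ≤ 0}) := by
    ext X; simp [polyAdjCone]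
  rw [h]
  refine isClosed_isSymm.inter (IsClosed.inter ?_ ?_)
  · exact isClosed_iInter fun i => isClosed_iInter fun j => isClosed_iInter fun _ =>
      isClosed_le continuous_const (by fun_prop)
  · exact isClosed_iInter fun i => isClosed_iInter fun j => isClosed_iInter fun _ =>
      isClosed_le (by fun_prop) continuous_const

variable [Fintype V]

/-- The dual cone of a set of matrices as a convex cone. -/
def dualConvexCone (K : Set (Matrix V V ℝ)) : ConvexCone ℝ (Matrix V V ℝ) where
  carrier := dualCone K
  smul_mem' c hc Y hY := ⟨hY.1.smul c, fun X hX => by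
    rw [transpose_smul, Matrix.mul_smul, trace_smul]
    exact mul_nonneg hc.le (hY.2 X hX)⟩
  add_mem' Y hY Z hZ := ⟨hY.1.add hZ.1, fun X hX => by
    rw [transpose_add, Matrix.mul_add, trace_add]
    exact add_nonneg (hY.2 X hX) (hZ.2 X hX)⟩

theorem isClosed_dualCone (K : Set (Matrix V V ℝ)) : IsClosed (dualCone K) := by
  have h : dualCone K = {Y : Matrix V V ℝ | Y.IsSymm} ∩
      ⋂ X ∈ K, {Y : Matrix V V ℝ | 0 ≤ (X * Yᵀ).trace} := by
    ext Y; simp [dualCone]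
  rw [h]
  refine isClosed_isSymm.inter (isClosed_biInter fun X _ => isClosed_le continuous_const ?_)
  simp only [trace_mul_transpose_eq_sum]
  fun_prop

theorem zero_mem_dualCone (K : Set (Matrix V V ℝ)) : 0 ∈ dualCone K :=
  ⟨Matrix.isSymm_zero, fun X _ => by simp⟩

theorem trace_vecMulVec_mul_transpose (v : V → ℝ) (Y : Matrix V V ℝ) :
    (vecMulVec v v * Yᵀ).trace = v ⬝ᵥ Y *ᵥ v := by
  rw [trace_mul_transpose_eq_sum, quadForm_eq_sum]
  exact Finset.sum_congr rfl fun i _ => Finset.sum_congr rfl fun j _ => by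
    rw [vecMulVec_apply]; ring

theorem posSemidef_vecMulVec (v : V → ℝ) : (vecMulVec v v).PosSemidef := by
  simpa using posSemidef_vecMulVec_self_star v

theorem dualCone_psd : dualCone (Psd V) = Psd V := by
  ext Y
  refine ⟨fun h => posSemidef_iff_quadForm.2 ⟨h.1, fun v => ?_⟩, fun h => ⟨?_, fun X hX =>
    trace_mul_transpose_nonneg hX h⟩⟩
  · rw [← trace_vecMulVec_mul_transpose]
    exact h.2 _ (posSemidef_vecMulVec v)
  · exact (posSemidef_iff_quadForm.1 h).1

theorem isClosed_psd : IsClosed (Psd V) := by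
  rw [← dualCone_psd]; exact isClosed_dualCone _

theorem complPositive_subset_psd : ComplPositive V ⊆ Psd V := fun Y hY =>
  posSemidef_iff_quadForm.2 ⟨hY.1, fun v => by
    rw [← trace_vecMulVec_mul_transpose]
    have h := posSemidef_iff_quadForm.1 (posSemidef_vecMulVec v)
    exact hY.2 _ ⟨h.1, fun x _ => h.2 x⟩⟩

variable [DecidableEq V]

/-- A multiple of the matrix unit at `(i, j)`, symmetrized. -/
def symSingle (i j : V) (c : ℝ) : Matrix V V ℝ := Matrix.single i j c + Matrix.single j i c

omit [Fintype V] in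
theorem isSymm_symSingle (i j : V) (c : ℝ) : (symSingle i j c).IsSymm := by
  simp [symSingle, Matrix.IsSymm, add_comm]

omit [Fintype V] in
theorem symSingle_nonneg {c : ℝ} (hc : 0 ≤ c) (i j a b : V) : 0 ≤ symSingle i j c a b := by
  simp only [symSingle, Matrix.add_apply, Matrix.single_apply]
  split_ifs <;> linarith

omit [Fintype V] in
theorem symSingle_nonpos {c : ℝ} (hc : c ≤ 0) (i j a b : V) : symSingle i j c a b ≤ 0 := by
  simp only [symSingle, Matrix.add_apply, Matrix.single_apply]
  split_ifs <;> linarith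

omit [Fintype V] in
theorem symSingle_eq_zero {i j : V} {c : ℝ} {a b : V} (h : ¬ (i = a ∧ j = b))
    (h' : ¬ (j = a ∧ i = b)) : symSingle i j c a b = 0 := by
  simp [symSingle, h, h']

theorem trace_symSingle_mul_transpose (i j : V) (c : ℝ) (Y : Matrix V V ℝ) :
    (symSingle i j c * Yᵀ).trace = c * (Y i j + Y j i) := by
  simp only [symSingle, add_mul, trace_add, Matrix.trace_single_mul, Matrix.transpose_apply,
    smul_eq_mul]
  ring

theorem trace_mul_transpose_symSingle (i j : V) (c : ℝ) (X : Matrix V V ℝ) :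
    (X * (symSingle i j c)ᵀ).trace = c * (X i j + X j i) := by
  rw [← trace_transpose, transpose_mul, transpose_transpose, trace_symSingle_mul_transpose]

omit [Fintype V] in
theorem symSingle_mem_polyAdjCone_of_nonneg {P Q : SimpleGraph V} {i j : V} (h : ¬ Q.Adj i j)
    {c : ℝ} (hc : 0 ≤ c) : symSingle i j c ∈ polyAdjCone P Q := by
  refine ⟨isSymm_symSingle i j c, fun a b _ => symSingle_nonneg hc i j a b, fun a b hab =>
    (symSingle_eq_zero ?_ ?_).le⟩
  · rintro ⟨rfl, rfl⟩; exact h hab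
  · rintro ⟨rfl, rfl⟩; exact h hab.symm

omit [Fintype V] in
theorem symSingle_mem_polyAdjCone_of_nonpos {P Q : SimpleGraph V} {i j : V} (h : ¬ P.Adj i j)
    {c : ℝ} (hc : c ≤ 0) : symSingle i j c ∈ polyAdjCone P Q := by
  refine ⟨isSymm_symSingle i j c, fun a b hab => (symSingle_eq_zero ?_ ?_).ge, fun a b _ =>
    symSingle_nonpos hc i j a b⟩
  · rintro ⟨rfl, rfl⟩; exact h hab
  · rintro ⟨rfl, rfl⟩; exact h hab.symm

/-- The dual of a polyhedral adjacency cone consists of the matrices with zero diagonal of the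
adjacency cone of the complementary sets of pairs, interchanged. -/
theorem mem_dualCone_polyAdjCone {P Q : SimpleGraph V} {A : Matrix V V ℝ} :
    A ∈ dualCone (polyAdjCone P Q) ↔ A ∈ polyAdjCone Qᶜ Pᶜ ∧ ∀ i, A i i = 0 := by
  constructor
  · intro h
    have hpos : ∀ i j, ¬ Q.Adj i j → 0 ≤ A i j := fun i j hij => by
      have h1 := h.2 _ (symSingle_mem_polyAdjCone_of_nonneg (P := P) hij zero_le_one)
      rw [trace_symSingle_mul_transpose, h.1.apply i j] at h1
      linarith
    have hneg : ∀ i j, ¬ P.Adj i j → A i j ≤ 0 := fun i j hij => by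
      have h1 := h.2 _ (symSingle_mem_polyAdjCone_of_nonpos (Q := Q) hij (c := -1) (by norm_num))
      rw [trace_symSingle_mul_transpose, h.1.apply i j] at h1
      linarith
    exact ⟨⟨h.1, fun i j hij => hpos i j ((SimpleGraph.compl_adj _ _ _).1 hij).2,
      fun i j hij => hneg i j ((SimpleGraph.compl_adj _ _ _).1 hij).2⟩,
      fun i => le_antisymm (hneg i i (P.irrefl)) (hpos i i (Q.irrefl))⟩
  · rintro ⟨⟨hs, hp, hn⟩, hd⟩
    refine ⟨hs, fun X hX => ?_⟩
    rw [trace_mul_transpose_eq_sum]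
    refine Finset.sum_nonneg fun i _ => Finset.sum_nonneg fun j _ => ?_
    by_cases hij : i = j
    · subst hij; simp [hd]
    rcases lt_trichotomy (X i j) 0 with h | h | h
    · exact mul_nonneg_of_nonpos_of_nonpos h.le
        (hn i j ⟨hij, fun hP => not_lt.2 (hX.2.1 i j hP) h⟩)
    · simp [h]
    · exact mul_nonneg h.le (hp i j ⟨hij, fun hQ => not_lt.2 (hX.2.2 i j hQ) h⟩)

theorem mem_polyAdjCone_of_mem_dualCone_dualCone {P Q : SimpleGraph V} {F : Matrix V V ℝ}
    (hF : F ∈ dualCone (dualCone (polyAdjCone P Q))) : F ∈ polyAdjCone P Q := by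
  have key : ∀ i j (c : ℝ), (∀ X ∈ polyAdjCone P Q, 0 ≤ c * X i j) → 0 ≤ c * F i j := by
    intro i j c h
    have h1 := hF.2 (symSingle i j c) ⟨isSymm_symSingle i j c, fun X hX => by
      rw [trace_mul_transpose_symSingle, hX.1.apply i j]
      linarith [h X hX]⟩
    rw [trace_symSingle_mul_transpose, hF.1.apply i j] at h1
    linarith
  refine ⟨hF.1, fun i j hij => ?_, fun i j hij => ?_⟩
  · have := key i j 1 fun X hX => by simpa using hX.2.1 i j hij
    linarith
  · have := key i j (-1) fun X hX => by simpa using hX.2.2 i j hij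
    linarith

theorem diagScale_mem_polyAdjCone {P Q : SimpleGraph V} {X : Matrix V V ℝ}
    (hX : X ∈ polyAdjCone P Q) {h : V → ℝ} (hh : ∀ i, 0 ≤ h i) :
    diagScale h X ∈ polyAdjCone P Q := by
  refine ⟨isSymm_diagScale hX.1, fun i j hij => ?_, fun i j hij => ?_⟩
  · rw [diagScale_apply]
    exact mul_nonneg (mul_nonneg (hh i) (hX.2.1 i j hij)) (hh j)
  · rw [diagScale_apply]
    exact mul_nonpos_of_nonpos_of_nonneg
      (mul_nonpos_of_nonneg_of_nonpos (hh i) (hX.2.2 i j hij)) (hh j)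

theorem diagScale_mem_polyAdjCone_self {P : SimpleGraph V} {X : Matrix V V ℝ}
    (hX : X ∈ polyAdjCone P P) (h : V → ℝ) : diagScale h X ∈ polyAdjCone P P := by
  have h0 : ∀ i j, P.Adj i j → diagScale h X i j = 0 := fun i j hij => by
    rw [diagScale_apply, le_antisymm (hX.2.2 i j hij) (hX.2.1 i j hij), mul_zero, zero_mul]
  exact ⟨isSymm_diagScale hX.1, fun i j hij => (h0 i j hij).ge, fun i j hij => (h0 i j hij).le⟩

omit [Fintype V] in
theorem diagonal_mem_polyAdjCone (P Q : SimpleGraph V) (d : V → ℝ) :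
    Matrix.diagonal d ∈ polyAdjCone P Q :=
  ⟨Matrix.isSymm_diagonal d, fun _ _ h => (Matrix.diagonal_apply_ne d h.ne).ge,
    fun _ _ h => (Matrix.diagonal_apply_ne d h.ne).le⟩

theorem diagScale_mem_psd {X : Matrix V V ℝ} (hX : X ∈ Psd V) (h : V → ℝ) :
    diagScale h X ∈ Psd V := by
  have hX' := posSemidef_iff_quadForm.1 hX
  exact posSemidef_iff_quadForm.2 ⟨isSymm_diagScale hX'.1, fun x => by
    rw [quadForm_diagScale]; exact hX'.2 _⟩

theorem diagScale_mem_copositive {X : Matrix V V ℝ} (hX : X ∈ Copositive V) {h : V → ℝ}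
    (hh : ∀ i, 0 ≤ h i) : diagScale h X ∈ Copositive V :=
  ⟨isSymm_diagScale hX.1, fun x hx => by
    rw [quadForm_diagScale]; exact hX.2 _ fun i => mul_nonneg (hh i) (hx i)⟩

theorem diagScale_mem_complPositive {Y : Matrix V V ℝ} (hY : Y ∈ ComplPositive V) {h : V → ℝ}
    (hh : ∀ i, 0 ≤ h i) : diagScale h Y ∈ ComplPositive V := by
  refine ⟨isSymm_diagScale hY.1, fun X hX => ?_⟩
  have h1 := hY.2 _ (diagScale_mem_copositive hX hh)
  rw [trace_mul_transpose_eq_sum] at h1 ⊢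
  refine h1.trans_eq (Finset.sum_congr rfl fun i _ => Finset.sum_congr rfl fun j _ => ?_)
  simp only [diagScale_apply]
  ring

omit [DecidableEq V] in
theorem copositive_diag_nonneg {X : Matrix V V ℝ} (hX : X ∈ Copositive V) (i : V) :
    0 ≤ X i i := by
  classical
  have h := hX.2 (Pi.single i 1) fun j => by
    by_cases hj : j = i
    · subst hj; simp
    · simp [hj]
  simpa using h

theorem diagonal_mem_complPositive {d : V → ℝ} (hd : ∀ i, 0 ≤ d i) :
    Matrix.diagonal d ∈ ComplPositive V := by
  refine ⟨Matrix.isSymm_diagonal d, fun X hX => ?_⟩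
  rw [Matrix.diagonal_transpose, Matrix.trace]
  refine Finset.sum_nonneg fun i _ => ?_
  rw [Matrix.diag_apply, Matrix.mul_diagonal]
  exact mul_nonneg (copositive_diag_nonneg hX i) (hd i)

omit [DecidableEq V] in
theorem complPositive_subset_symNonneg : ComplPositive V ⊆ SymNonneg V := by
  classical
  refine fun Y hY => ⟨hY.1, fun i j => ?_⟩
  have h := hY.2 (symSingle i j 1) ⟨isSymm_symSingle i j 1, fun x hx => by
    rw [quadForm_eq_sum]
    exact Finset.sum_nonneg fun a _ => Finset.sum_nonneg fun b _ =>
      mul_nonneg (mul_nonneg (hx a) (symSingle_nonneg zero_le_one i j a b)) (hx b)⟩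
  rw [trace_symSingle_mul_transpose, hY.1.apply i j] at h
  linarith

omit [DecidableEq V] in
theorem vecMulVec_mem_complPositive {v : V → ℝ} (hv : ∀ i, 0 ≤ v i) :
    vecMulVec v v ∈ ComplPositive V := by
  refine ⟨(posSemidef_iff_quadForm.1 (posSemidef_vecMulVec v)).1, fun X hX => ?_⟩
  rw [← trace_transpose, transpose_mul, transpose_transpose, trace_vecMulVec_mul_transpose]
  exact hX.2 v hv

omit [Fintype V] [DecidableEq V] in
theorem posSemidef_sq_le {X : Matrix V V ℝ} (hX : X.PosSemidef) (i j : V) :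
    X i j ^ 2 ≤ X i i * X j j := by
  have h := (hX.submatrix ![i, j]).det_nonneg
  rw [Matrix.det_fin_two] at h
  have hs : X j i = X i j := by simpa using hX.isHermitian.apply i j
  simp only [submatrix_apply, cons_val_zero, cons_val_one, hs] at h
  nlinarith

omit [DecidableEq V] in
theorem isCompact_psd_trace_one {S : Set (Matrix V V ℝ)} (hS : IsClosed S) (hSp : S ⊆ Psd V) :
    IsCompact {X : Matrix V V ℝ | X ∈ S ∧ X.trace = 1} := by
  have hbox : IsCompact {X : Matrix V V ℝ | ∀ i j, X i j ∈ Set.Icc (-1 : ℝ) 1} := by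
    have h : IsCompact (Set.univ.pi fun _ : V => Set.univ.pi fun _ : V => Set.Icc (-1 : ℝ) 1) :=
      isCompact_univ_pi fun _ => isCompact_univ_pi fun _ => isCompact_Icc
    have heq : {X : Matrix V V ℝ | ∀ i j, X i j ∈ Set.Icc (-1 : ℝ) 1} =
        Set.univ.pi fun _ : V => Set.univ.pi fun _ : V => Set.Icc (-1 : ℝ) 1 :=
      Set.ext fun X => ⟨fun h i _ j _ => h i j, fun h i j => h i trivial j trivial⟩
    rw [heq]; exact h
  refine hbox.of_isClosed_subset (hS.inter (isClosed_eq ?_ continuous_const)) ?_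
  · exact continuous_id.matrix_trace
  · rintro X ⟨hX, htr⟩ i j
    have hp : X.PosSemidef := hSp hX
    have hle : ∀ k, X k k ≤ 1 := fun k => by
      rw [← htr]
      exact Finset.single_le_sum (f := fun k => X k k) (fun k _ => hp.diag_nonneg)
        (Finset.mem_univ k)
    have h1 := posSemidef_sq_le hp i j
    have h2 : X i i * X j j ≤ 1 := mul_le_one₀ (hle i) hp.diag_nonneg (hle j)
    exact abs_le.1 (abs_le_one_iff_mul_self_le_one.2 (by nlinarith))

variable [Nonempty V]

/-- The scaling-invariant cone duality for the part of a polyhedral adjacency cone inside a closed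
subcone of the positive semidefinite cone, with the all-ones weights. -/
theorem exists_isGreatest_lambdaMax_polyAdj (P Q : SimpleGraph V)
    (K : ConvexCone ℝ (Matrix V V ℝ)) (hK : IsClosed (K : Set (Matrix V V ℝ)))
    (hKp : (K : Set (Matrix V V ℝ)) ⊆ Psd V)
    (hKs : DiagScalingInvariant (K : Set (Matrix V V ℝ)))
    (hKd : ∀ d : V → ℝ, (∀ i, 0 ≤ d i) → Matrix.diagonal d ∈ K)
    (hor : (∀ h : V → ℝ, ∀ X ∈ polyAdjConvexCone P Q ⊓ K,
        diagScale h X ∈ polyAdjConvexCone P Q ⊓ K) ∨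
      ((polyAdjConvexCone P Q ⊓ K : ConvexCone ℝ (Matrix V V ℝ)) : Set (Matrix V V ℝ)) ⊆
        SymNonneg V) :
    ∃ m : ℝ,
      IsGreatest {r : ℝ | ∃ B ∈ polyAdjConvexCone P Q ⊓ K, B.diag = 1 ∧ r = lambdaMax B} m ∧
      IsGreatest {r : ℝ | ∃ X ∈ polyAdjConvexCone P Q ⊓ K, X.trace = 1 ∧
        r = (1 : V → ℝ) ⬝ᵥ X *ᵥ 1} m := by
  have h := exists_isGreatest_lambdaMax_quadForm (polyAdjConvexCone P Q ⊓ K)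
    (fun X hX => hX.1.1)
    (fun h hh X hX => ⟨diagScale_mem_polyAdjCone hX.1 hh, hKs h hh X hX.2⟩)
    (fun X hX i => (hKp hX.2 : X.PosSemidef).diag_nonneg)
    (fun X hX i hi j => by
      have h1 := posSemidef_sq_le (hKp hX.2) j i
      rw [hi, mul_zero] at h1
      exact pow_eq_zero_iff two_ne_zero |>.1 (le_antisymm h1 (sq_nonneg _)))
    (isCompact_psd_trace_one (S := polyAdjCone P Q ∩ K) ((isClosed_polyAdjCone P Q).inter hK)
      fun X hX => hKp hX.2)
    (fun d hd => ⟨diagonal_mem_polyAdjCone P Q d, hKd d hd⟩) hor 1 (fun _ => zero_le_one)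
  have hone : (fun i : V => √((1 : V → ℝ) i)) = 1 := by ext i; simp
  rwa [hone] at h

end Cones

section Duality

variable {V : Type*} [Fintype V]

/-- The value of a linear functional at a symmetric matrix is the trace pairing with a symmetric
matrix. -/
theorem exists_isSymm_trace_eq (f : (V → V → ℝ) →ₗ[ℝ] ℝ) :
    ∃ F : Matrix V V ℝ, F.IsSymm ∧ ∀ X : Matrix V V ℝ, X.IsSymm → f X = (X * Fᵀ).trace := by
  classical
  let g : Matrix V V ℝ →ₗ[ℝ] ℝ := f
  let C : Matrix V V ℝ := fun i j => g (Matrix.single i j 1)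
  have hg : ∀ X, g X = ∑ i, ∑ j, X i j * C i j := fun X => by
    conv_lhs => rw [Matrix.matrix_eq_sum_single X]
    simp only [map_sum]
    refine Finset.sum_congr rfl fun i _ => Finset.sum_congr rfl fun j _ => ?_
    rw [← mul_one (X i j), ← smul_eq_mul, ← Matrix.smul_single, map_smul]
    simp [C]
  refine ⟨(1 / 2 : ℝ) • (C + Cᵀ), ?_, fun X hX => ?_⟩
  · simp [Matrix.IsSymm, add_comm]
  · have h1 : ∑ i, ∑ j, X i j * C j i = ∑ i, ∑ j, X i j * C i j := by
      rw [Finset.sum_comm]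
      exact Finset.sum_congr rfl fun i _ => Finset.sum_congr rfl fun j _ => by rw [hX.apply]
    change g X = _
    rw [hg, trace_mul_transpose_eq_sum]
    simp only [Matrix.smul_apply, Matrix.add_apply, Matrix.transpose_apply, smul_eq_mul]
    have h2 : ∀ i j, X i j * (1 / 2 * (C i j + C j i)) =
        1 / 2 * (X i j * C i j) + 1 / 2 * (X i j * C j i) := fun i j => by ring
    simp only [h2, Finset.sum_add_distrib, ← Finset.mul_sum, h1]
    ring

/-- A symmetric matrix which is nonnegative on `L ∩ Psd` for the bidual `L` of a set `A` is a limit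
of sums of a matrix of the dual cone of `A` and a positive semidefinite matrix. -/
theorem mem_closure_dualCone_add_psd {A : Set (Matrix V V ℝ)} {C : Matrix V V ℝ} (hC : C.IsSymm)
    (h : ∀ F ∈ dualCone (dualCone A), F ∈ Psd V → 0 ≤ (C * Fᵀ).trace) :
    C ∈ closure {X : Matrix V V ℝ | ∃ N ∈ dualCone A, ∃ R ∈ Psd V, X = N + R} := by
  set S : Set (Matrix V V ℝ) := {X | ∃ N ∈ dualCone A, ∃ R ∈ Psd V, X = N + R} with hS
  by_contra hCS
  have hsmul : ∀ {c : ℝ}, 0 < c → ∀ X ∈ S, c • X ∈ S := by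
    rintro c hc X ⟨N, hN, R, hR, rfl⟩
    exact ⟨c • N, (dualConvexCone A).smul_mem hc hN, c • R, (psdConvexCone V).smul_mem hc hR,
      smul_add c N R⟩
  have hadd : ∀ X ∈ S, ∀ Y ∈ S, X + Y ∈ S := by
    rintro X ⟨N, hN, R, hR, rfl⟩ Y ⟨N', hN', R', hR', rfl⟩
    exact ⟨N + N', (dualConvexCone A).add_mem hN hN', R + R', (psdConvexCone V).add_mem hR hR',
      add_add_add_comm N R N' R'⟩
  have hconv : Convex ℝ S := by
    rw [convex_iff_forall_pos]
    exact fun X hX Y hY a b ha hb _ => hadd _ (hsmul ha X hX) _ (hsmul hb Y hY)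
  obtain ⟨f, u, hfu, hfS⟩ := geometric_hahn_banach_point_closed (E := V → V → ℝ)
    (t := closure S) (x := C) (Convex.closure (E := V → V → ℝ) hconv) isClosed_closure hCS
  obtain ⟨F, hFs, hF⟩ := exists_isSymm_trace_eq f.toLinearMap
  have hpsd0 : (0 : Matrix V V ℝ) ∈ Psd V := Matrix.PosSemidef.zero
  have h0S : (0 : Matrix V V ℝ) ∈ S :=
    ⟨0, zero_mem_dualCone A, 0, hpsd0, (add_zero 0).symm⟩
  have hu : u < 0 := by
    have := hfS 0 (subset_closure h0S)
    rwa [map_zero] at this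
  have hpos : ∀ X ∈ S, 0 ≤ f X := by
    intro X hX
    by_contra! hneg
    have h1 := hfS _ (subset_closure (hsmul (div_pos_of_neg_of_neg hu hneg) X hX))
    have h2 := f.map_smul (u / f X) X
    exact lt_irrefl u (h1.trans_eq (h2.trans (div_mul_cancel₀ u hneg.ne)))
  have hFd : F ∈ dualCone (dualCone A) := ⟨hFs, fun N hN => by
    rw [← hF N hN.1]; exact hpos N ⟨N, hN, 0, hpsd0, (add_zero N).symm⟩⟩
  have hFp : F ∈ Psd V := by
    rw [← dualCone_psd]
    exact ⟨hFs, fun R hR => by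
      rw [← hF R (posSemidef_iff_quadForm.1 hR).1]
      exact hpos R ⟨0, zero_mem_dualCone A, R, hR, (zero_add R).symm⟩⟩
  have h1 := h F hFd hFp
  rw [← hF C hC] at h1
  exact absurd (h1.trans_lt hfu) (not_lt.2 hu.le)

variable [DecidableEq V]

/-- A symmetric matrix with entries of absolute value at most `δ` becomes positive semidefinite
after adding `|V| δ` to its diagonal. -/
theorem posSemidef_add_smul_one {E : Matrix V V ℝ} (hE : E.IsSymm) {δ : ℝ}
    (h : ∀ i j, |E i j| ≤ δ) :
    (E + (Fintype.card V * δ) • (1 : Matrix V V ℝ)).PosSemidef := by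
  refine posSemidef_iff_quadForm.2 ⟨hE.add (Matrix.isSymm_one.smul _), fun x => ?_⟩
  rw [quadForm_add, quadForm_smul, quadForm_one]
  rcases isEmpty_or_nonempty V with hV | ⟨⟨k⟩⟩
  · simp
  have hδ : 0 ≤ δ := (abs_nonneg _).trans (h k k)
  have h1 : -(x ⬝ᵥ E *ᵥ x) ≤ δ * (∑ i, |x i|) ^ 2 := by
    rw [quadForm_eq_sum, sq, Finset.sum_mul_sum, Finset.mul_sum, ← Finset.sum_neg_distrib]
    refine Finset.sum_le_sum fun i _ => ?_
    rw [Finset.mul_sum, ← Finset.sum_neg_distrib]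
    refine Finset.sum_le_sum fun j _ => (neg_le_abs _).trans ?_
    rw [abs_mul, abs_mul]
    calc |x i| * |E i j| * |x j| ≤ |x i| * δ * |x j| := by gcongr; exact h i j
      _ = δ * (|x i| * |x j|) := by ring
  have h2 : (∑ i, |x i|) ^ 2 ≤ Fintype.card V * (x ⬝ᵥ x) := by
    have := sq_sum_le_card_mul_sum_sq (s := Finset.univ) (f := fun i => |x i|)
    simpa [dotProduct, sq] using this
  have h3 := mul_le_mul_of_nonneg_left h2 hδ
  nlinarith

variable [Nonempty V]

/-- Strong duality for the trace-one problem over `polyAdjCone P Q ∩ Psd`, up to `ε`. -/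
theorem exists_dual_solution {P Q : SimpleGraph V} {p : ℝ}
    (hp : ∀ X ∈ polyAdjConvexCone P Q ⊓ psdConvexCone V, X.trace = 1 →
      (1 : V → ℝ) ⬝ᵥ X *ᵥ 1 ≤ p) {ε : ℝ} (hε : 0 < ε) :
    ∃ N ∈ dualCone (polyAdjCone P Q),
      ((p + ε) • (1 : Matrix V V ℝ) - vecMulVec 1 1 - N).PosSemidef := by
  set C : Matrix V V ℝ := p • 1 - vecMulVec 1 1 with hCdef
  have hJs : (vecMulVec (1 : V → ℝ) (1 : V → ℝ)).IsSymm :=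
    (posSemidef_iff_quadForm.1 (posSemidef_vecMulVec 1)).1
  have hCs : C.IsSymm := (Matrix.isSymm_one.smul p).sub hJs
  have hC : C ∈ closure {X : Matrix V V ℝ |
      ∃ N ∈ dualCone (polyAdjCone P Q), ∃ R ∈ Psd V, X = N + R} := by
    refine mem_closure_dualCone_add_psd hCs fun F hF hFp => ?_
    have hFM : F ∈ polyAdjConvexCone P Q ⊓ psdConvexCone V :=
      ⟨mem_polyAdjCone_of_mem_dualCone_dualCone hF, hFp⟩
    have htr : 0 ≤ F.trace := Matrix.PosSemidef.trace_nonneg hFp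
    have hval : (C * Fᵀ).trace = p * F.trace - (1 : V → ℝ) ⬝ᵥ F *ᵥ 1 := by
      rw [hCdef, Matrix.sub_mul, trace_sub, trace_vecMulVec_mul_transpose, Matrix.smul_mul,
        one_mul, trace_smul, trace_transpose, smul_eq_mul]
    rw [hval, sub_nonneg]
    rcases htr.eq_or_lt with h0 | hpos
    · rw [(Matrix.PosSemidef.trace_eq_zero_iff hFp).1 h0.symm]
      simp
    · have h := hp (F.trace⁻¹ • F) (ConvexCone.smul_mem _ (inv_pos.2 hpos) hFM)
        (by rw [Matrix.trace_smul, smul_eq_mul, inv_mul_cancel₀ hpos.ne'])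
      rw [quadForm_smul] at h
      rwa [inv_mul_le_iff₀ hpos, mul_comm] at h
  have hn : (0 : ℝ) < Fintype.card V := by exact_mod_cast Fintype.card_pos
  have hopen : IsOpen {X : Matrix V V ℝ | ∀ i j, |C i j - X i j| < ε / Fintype.card V} := by
    have h : {X : Matrix V V ℝ | ∀ i j, |C i j - X i j| < ε / Fintype.card V} =
        ⋂ i, ⋂ j, {X : Matrix V V ℝ | |C i j - X i j| < ε / Fintype.card V} := by
      ext X; simp
    rw [h]
    exact isOpen_iInter_of_finite fun i => isOpen_iInter_of_finite fun j =>
      isOpen_lt (by fun_prop) continuous_const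
  obtain ⟨_, hX, N, hN, R, hR, rfl⟩ := mem_closure_iff.1 hC _ hopen fun i j => by
    simpa using div_pos hε hn
  refine ⟨N, hN, ?_⟩
  have hE := posSemidef_add_smul_one (E := C - (N + R)) (δ := ε / Fintype.card V)
    (hCs.sub (hN.1.add (posSemidef_iff_quadForm.1 hR).1)) fun i j => (hX i j).le
  rw [mul_div_cancel₀ _ hn.ne'] at hE
  have heq : (p + ε) • (1 : Matrix V V ℝ) - vecMulVec 1 1 - N =
      (C - (N + R) + ε • (1 : Matrix V V ℝ)) + R := by
    rw [hCdef, add_smul]; abel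
  rw [heq]
  exact hE.add hR

end Duality

section ThetaBody

variable {V : Type*} [Fintype V]

theorem mem_genTH_schurLift_psd {A : Set (Matrix V V ℝ)} {x : V → ℝ} :
    x ∈ genTH A (schurLift (dualCone (Psd V))) ↔
      ∃ X ∈ A, X.PosSemidef ∧ (X - vecMulVec x x).PosSemidef ∧ X.diag = x := by
  rw [dualCone_psd]
  constructor
  · rintro ⟨X, ⟨⟨-, hXp, -, hS⟩, h00, hdiag, hXA⟩, rfl⟩
    refine ⟨X.submatrix some some, hXA, hXp, ?_, rfl⟩
    have h : (fun i => X (some i) none) = (X.submatrix some some).diag :=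
      funext fun i => hdiag (some i)
    have hS' : (X none none • X.submatrix some some -
      vecMulVec (fun i => X (some i) none) (fun i => X (some i) none)).PosSemidef := hS
    simpa only [h00, one_smul, h] using hS'
  · rintro ⟨X, hXA, hXp, hS, rfl⟩
    have hXs := (posSemidef_iff_quadForm.1 hXp).1
    let Y : Matrix (Option V) (Option V) ℝ := fun a b => match a, b with
      | none, none => 1
      | none, some j => X j j
      | some i, none => X i i
      | some i, some j => X i j
    refine ⟨Y, ⟨⟨?_, hXp, zero_le_one, ?_⟩, rfl, ?_, hXA⟩, rfl⟩
    · ext (_ | i) (_ | j)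
      · rfl
      · rfl
      · rfl
      · exact hXs.apply i j
    · change ((1 : ℝ) • X - vecMulVec X.diag X.diag).PosSemidef
      rwa [one_smul]
    · rintro (_ | i) <;> rfl

variable [DecidableEq V]

/-- Membership of the constant vector `1 / t` in the theta body, from a dual solution of
value `t`. -/
theorem const_mem_genTH {P Q : SimpleGraph V} {t : ℝ} (ht : 0 < t) {N : Matrix V V ℝ}
    (hN : N ∈ dualCone (polyAdjCone P Q))
    (hR : (t • (1 : Matrix V V ℝ) - vecMulVec 1 1 - N).PosSemidef) :
    (fun _ => t⁻¹) ∈ genTH (adjDual (polyAdjCone P Q)) (schurLift (dualCone (Psd V))) := by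
  have hc : 0 < t⁻¹ * t⁻¹ := by positivity
  have hNd := (mem_dualCone_polyAdjCone.1 hN).2
  have hJ : vecMulVec (fun _ : V => t⁻¹) (fun _ => t⁻¹) =
      (t⁻¹ * t⁻¹) • vecMulVec (1 : V → ℝ) (1 : V → ℝ) := by
    ext i j; simp [vecMulVec_apply]
  have hdiagt : Matrix.diagonal (fun _ : V => t⁻¹) = (t⁻¹ * t⁻¹) • t • (1 : Matrix V V ℝ) := by
    rw [smul_smul, mul_assoc, inv_mul_cancel₀ ht.ne', mul_one, Matrix.smul_one_eq_diagonal]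
  have heq : Matrix.diagonal (fun _ => t⁻¹) - (t⁻¹ * t⁻¹) • N - vecMulVec (fun _ => t⁻¹)
      (fun _ => t⁻¹) = (t⁻¹ * t⁻¹) • (t • (1 : Matrix V V ℝ) - vecMulVec 1 1 - N) := by
    rw [hJ, hdiagt, smul_sub, smul_sub]; abel
  have hpsd : (Matrix.diagonal (fun _ => t⁻¹) - (t⁻¹ * t⁻¹) • N - vecMulVec (fun _ => t⁻¹)
      (fun _ => t⁻¹)).PosSemidef := by
    rw [heq]; exact hR.smul hc.le
  refine mem_genTH_schurLift_psd.2 ⟨Matrix.diagonal (fun _ => t⁻¹) - (t⁻¹ * t⁻¹) • N,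
    ⟨_, _, (dualConvexCone _).smul_mem hc hN, rfl⟩, ?_, hpsd, ?_⟩
  · have := hpsd.add (posSemidef_vecMulVec fun _ : V => t⁻¹)
    rwa [sub_add_cancel] at this
  · ext i
    simp [hNd i]

/-- The inequality between the theta bodies of an adjacency cone and of its dual. -/
theorem dotProduct_le_one_of_mem_genTH {P Q : SimpleGraph V} {Y : Matrix V V ℝ}
    (hY : Y ∈ polyAdjCone P Q) (hYp : Y.PosSemidef)
    (hYS : (Y - vecMulVec Y.diag Y.diag).PosSemidef) {x : V → ℝ}
    (hx : x ∈ genTH (adjDual (polyAdjCone P Q)) (schurLift (dualCone (Psd V)))) :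
    Y.diag ⬝ᵥ x ≤ 1 := by
  obtain ⟨X, ⟨d, N, hN, rfl⟩, hXp, hXS, hXx⟩ := mem_genTH_schurLift_psd.1 hx
  have hNd := (mem_dualCone_polyAdjCone.1 hN).2
  have hd : d = x := by
    ext i; rw [← hXx]; simp [hNd]
  subst hd
  have h1 := trace_mul_transpose_nonneg hXS hYp
  rw [Matrix.sub_mul, trace_sub, trace_vecMulVec_mul_transpose, sub_nonneg] at h1
  have h2 := (posSemidef_iff_quadForm.1 hYS).2 d
  rw [Matrix.sub_mulVec, dotProduct_sub, sub_nonneg] at h2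
  have h3 : d ⬝ᵥ vecMulVec Y.diag Y.diag *ᵥ d = (Y.diag ⬝ᵥ d) ^ 2 := by
    rw [quadForm_eq_sum, sq]
    simp only [dotProduct, Finset.sum_mul_sum]
    exact Finset.sum_congr rfl fun i _ => Finset.sum_congr rfl fun j _ => by
      rw [vecMulVec_apply]; ring
  have h4 := hN.2 Y hY
  have h5 : ((Matrix.diagonal d - N) * Yᵀ).trace = Y.diag ⬝ᵥ d - (Y * Nᵀ).trace := by
    rw [Matrix.sub_mul, trace_sub, ← trace_transpose (N * Yᵀ), transpose_mul, transpose_transpose]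
    congr 1
    simp [Matrix.trace, Matrix.diagonal_mul, dotProduct, mul_comm]
  nlinarith

variable [Nonempty V]

theorem one_le_of_isGreatest_lambdaMax {P Q : SimpleGraph V} {K : ConvexCone ℝ (Matrix V V ℝ)}
    (hK : 1 ∈ K) {p : ℝ}
    (hp : IsGreatest {r : ℝ | ∃ B ∈ polyAdjConvexCone P Q ⊓ K, B.diag = 1 ∧ r = lambdaMax B} p) :
    1 ≤ p := by
  have h : lambdaMax (1 : Matrix V V ℝ) = 1 := by
    have := lambdaMax_smul_add_smul_one (V := V) Matrix.isSymm_zero le_rfl (1 : ℝ)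
    simpa using this
  rw [← h]
  refine hp.2 ⟨1, ⟨?_, hK⟩, Matrix.diag_one, rfl⟩
  rw [← Matrix.diagonal_one]
  exact diagonal_mem_polyAdjCone P Q _

/-- The theta function with all-ones weights, as the largest eigenvalue of a positive semidefinite
matrix of the adjacency cone with unit diagonal. -/
theorem isGreatest_linValues_thetaRegion {P Q : SimpleGraph V} {p : ℝ}
    (hor : (∀ h : V → ℝ, ∀ X ∈ polyAdjConvexCone P Q ⊓ psdConvexCone V,
        diagScale h X ∈ polyAdjConvexCone P Q ⊓ psdConvexCone V) ∨
      ((polyAdjConvexCone P Q ⊓ psdConvexCone V : ConvexCone ℝ (Matrix V V ℝ)) :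
        Set (Matrix V V ℝ)) ⊆ SymNonneg V)
    (hp : IsGreatest {r : ℝ | ∃ B ∈ polyAdjConvexCone P Q ⊓ psdConvexCone V,
      B.diag = 1 ∧ r = lambdaMax B} p)
    (hp' : IsGreatest {r : ℝ | ∃ X ∈ polyAdjConvexCone P Q ⊓ psdConvexCone V,
      X.trace = 1 ∧ r = (1 : V → ℝ) ⬝ᵥ X *ᵥ 1} p) :
    IsGreatest (linValues (thetaRegion (polyAdjCone P Q) (Psd V)) 1) p := by
  have hp1 : 1 ≤ p := one_le_of_isGreatest_lambdaMax Matrix.PosSemidef.one hp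
  have hp0 : 0 < p := zero_lt_one.trans_le hp1
  constructor
  · obtain ⟨B, hB, hBd, hpB⟩ := hp.1
    have hBp : B.PosSemidef := hB.2
    have hBs : B.IsSymm := hB.1.1
    obtain ⟨v, hv1, hvM, hvB⟩ : ∃ v : V → ℝ, v ⬝ᵥ v = 1 ∧
        diagScale v B ∈ polyAdjConvexCone P Q ⊓ psdConvexCone V ∧ B *ᵥ v = p • v := by
      obtain ⟨v, hv, h⟩ := exists_eigenvector_lambdaMax hBs
      rcases hor with hor | hor
      · exact ⟨v, hv, hor v B hB, by rw [hpB, h]⟩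
      · have hv' : (fun i => |v i|) ⬝ᵥ (fun i => |v i|) = 1 := by
          rw [← hv]; exact Finset.sum_congr rfl fun i _ => abs_mul_abs_self _
        refine ⟨fun i => |v i|, hv', ⟨diagScale_mem_polyAdjCone hB.1 fun i => abs_nonneg _,
          diagScale_mem_psd hB.2 _⟩, ?_⟩
        have h1 := lambdaMax_le_quadForm_abs (hor hB) (v := v)
          (by rw [h, dotProduct_smul, hv, smul_eq_mul, mul_one])
        have h2 := posSemidef_smul_one_sub hBs (isGreatest_lambdaMax hBs).2
        have h3 := (h2.dotProduct_mulVec_zero_iff (fun i => |v i|)).1 (by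
          refine le_antisymm ?_ (h2.dotProduct_mulVec_nonneg _)
          rw [star_trivial, Matrix.sub_mulVec, dotProduct_sub, quadForm_smul, quadForm_one, hv']
          linarith)
        rw [Matrix.sub_mulVec, Matrix.smul_mulVec, Matrix.one_mulVec, sub_eq_zero] at h3
        rw [hpB, h3]
    have hBii : ∀ i, B i i = 1 := fun i => congrFun hBd i
    set Y : Matrix V V ℝ := p • diagScale v B with hY
    have hYM : Y ∈ polyAdjConvexCone P Q ⊓ psdConvexCone V := ConvexCone.smul_mem _ hp0 hvM
    have hYd : Y.diag = fun i => p * v i ^ 2 := by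
      ext i
      simp only [hY, Matrix.diag_apply, Matrix.smul_apply, diagScale_apply, hBii, smul_eq_mul]
      ring
    have hdefl : (B - p • vecMulVec v v).PosSemidef := by
      refine posSemidef_iff_quadForm.2 ⟨hBs.sub
        ((posSemidef_iff_quadForm.1 (posSemidef_vecMulVec v)).1.smul p), fun x => ?_⟩
      have h := (posSemidef_iff_quadForm.1 hBp).2 (x - (v ⬝ᵥ x) • v)
      have hvx : v ⬝ᵥ B *ᵥ x = p * (v ⬝ᵥ x) := by
        rw [dotProduct_mulVec, ← mulVec_transpose, hBs.eq, hvB, smul_dotProduct, smul_eq_mul]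
      have hvv : x ⬝ᵥ vecMulVec v v *ᵥ x = (v ⬝ᵥ x) ^ 2 := by
        rw [quadForm_eq_sum, sq]
        simp only [dotProduct, Finset.sum_mul_sum]
        exact Finset.sum_congr rfl fun i _ => Finset.sum_congr rfl fun j _ => by
          rw [vecMulVec_apply]; ring
      simp only [Matrix.mulVec_sub, Matrix.mulVec_smul, sub_dotProduct, dotProduct_sub,
        smul_dotProduct, dotProduct_smul, smul_eq_mul, hvB, hvx, hv1, dotProduct_comm x v] at h
      rw [Matrix.sub_mulVec, dotProduct_sub, quadForm_smul, hvv]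
      nlinarith
    have hYS : (Y - vecMulVec Y.diag Y.diag).PosSemidef := by
      have heq : Y - vecMulVec Y.diag Y.diag = p • diagScale v (B - p • vecMulVec v v) := by
        rw [hYd]
        ext i j
        simp only [hY, Matrix.sub_apply, Matrix.smul_apply, diagScale_apply, vecMulVec_apply,
          smul_eq_mul]
        ring
      rw [heq]
      exact Matrix.PosSemidef.smul (diagScale_mem_psd hdefl v) hp0.le
    refine ⟨Y.diag, ⟨fun i => ?_, fun x hx => ?_⟩, ?_⟩
    · rw [hYd]; positivity
    · have hcl : IsClosed {x : V → ℝ | Y.diag ⬝ᵥ x ≤ 1} :=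
        isClosed_le (f := fun x : V → ℝ => ∑ i, Y.diag i * x i) (by fun_prop) continuous_const
      exact closure_minimal
        (fun z hz => dotProduct_le_one_of_mem_genTH hYM.1 hYM.2 hYS hz) hcl hx
    · change 1 ⬝ᵥ Y.diag = p
      rw [hYd, one_dotProduct, ← Finset.mul_sum]
      have : ∑ i, v i ^ 2 = v ⬝ᵥ v := Finset.sum_congr rfl fun i _ => sq (v i)
      rw [this, hv1, mul_one]
  · rintro _ ⟨y, ⟨-, hy⟩, rfl⟩
    refine le_of_forall_pos_le_add fun ε hε => ?_
    obtain ⟨N, hN, hR⟩ := exists_dual_solution (P := P) (Q := Q)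
      (fun X hX htr => hp'.2 ⟨X, hX, htr, rfl⟩) hε
    have ht : 0 < p + ε := by positivity
    have h := hy _ (subset_closure (const_mem_genTH ht hN hR))
    have h2 : y ⬝ᵥ (fun _ => (p + ε)⁻¹) = (p + ε)⁻¹ * (1 ⬝ᵥ y) := by
      simp [dotProduct, Finset.sum_mul, mul_comm]
    rwa [h2, inv_mul_le_iff₀ ht, mul_one] at h

end ThetaBody

section HoffmanBounds

variable {V : Type*} [Fintype V] [DecidableEq V] [Nonempty V]

theorem iverson_mul_of_pos {P : Prop} (h : P) (t : ℝ) : iverson P * t = t := by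
  simp [iverson, h]

theorem iverson_mul_of_not {P : Prop} (h : ¬ P) (t : ℝ) : iverson P * t = 0 := by
  simp [iverson, h]

theorem lambdaMin_neg {A : Matrix V V ℝ} (hA : A.IsSymm) (hd : ∀ i, A i i = 0) (hA0 : A ≠ 0) :
    lambdaMin A < 0 := by
  by_contra! h
  have hpsd := posSemidef_sub_smul_one hA (c := 0) fun x hx => h.trans ((isLeast_lambdaMin hA).2 hx)
  rw [zero_smul, sub_zero] at hpsd
  exact hA0 (hpsd.trace_eq_zero_iff.1 (Finset.sum_eq_zero fun i _ => hd i))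

theorem le_lambdaMin {A : Matrix V V ℝ} {c : ℝ} (hA : A.IsSymm)
    (h : (A - c • (1 : Matrix V V ℝ)).PosSemidef) : c ≤ lambdaMin A := by
  obtain ⟨v, hv, hAv⟩ := exists_unit_eigenvector hA (isLeast_lambdaMin hA).1
  have h1 := (posSemidef_iff_quadForm.1 h).2 v
  rw [Matrix.sub_mulVec, dotProduct_sub, quadForm_smul, quadForm_one, hAv, dotProduct_smul, hv,
    smul_eq_mul] at h1
  linarith

/-- The ratio of a matrix of the adjacency cone with zero diagonal and a shift that moves it into
`K` is bounded by the eigenvalue problem over the matrices with unit diagonal. -/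
theorem one_sub_lambdaMax_div_le {P Q : SimpleGraph V} {K : ConvexCone ℝ (Matrix V V ℝ)} {p : ℝ}
    (hp : IsGreatest {r : ℝ | ∃ B ∈ polyAdjConvexCone P Q ⊓ K, B.diag = 1 ∧ r = lambdaMax B} p)
    {A : Matrix V V ℝ} (hA : A ∈ polyAdjCone P Q) (hd : ∀ i, A i i = 0) {μ : ℝ} (hμ : μ < 0)
    (hK : A - μ • (1 : Matrix V V ℝ) ∈ K) : 1 - lambdaMax A / μ ≤ p := by
  have hc : 0 < (-μ)⁻¹ := inv_pos.2 (neg_pos.2 hμ)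
  have heq : (-μ)⁻¹ • (A - μ • (1 : Matrix V V ℝ)) = (-μ)⁻¹ • A + (1 : ℝ) • 1 := by
    rw [smul_sub, smul_smul, sub_eq_add_neg, ← neg_smul]
    congr 2
    have := hμ.ne
    field_simp
  have hval : lambdaMax ((-μ)⁻¹ • (A - μ • (1 : Matrix V V ℝ))) = 1 - lambdaMax A / μ := by
    rw [heq, lambdaMax_smul_add_smul_one hA.1 hc.le]
    field_simp
    ring
  rw [← hval]
  refine hp.2 ⟨_, ⟨?_, K.smul_mem hc hK⟩, ?_, rfl⟩
  · rw [heq, one_smul, ← Matrix.diagonal_one]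
    exact (polyAdjConvexCone P Q).add_mem ((polyAdjConvexCone P Q).smul_mem hc hA)
      (diagonal_mem_polyAdjCone P Q _)
  · rw [heq]
    ext i
    simp [hd]

/-- The eigenvalue problem over the matrices with unit diagonal is attained by a matrix of the
form `A + I` with `A` in the dual of the complementary adjacency cone. -/
theorem exists_mem_dualCone_lambdaMax_add_one {P Q : SimpleGraph V}
    {K : ConvexCone ℝ (Matrix V V ℝ)} {p : ℝ}
    (hp : IsGreatest {r : ℝ | ∃ B ∈ polyAdjConvexCone P Q ⊓ K, B.diag = 1 ∧ r = lambdaMax B} p) :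
    ∃ A ∈ dualCone (polyAdjCone Qᶜ Pᶜ), A - (-1 : ℝ) • (1 : Matrix V V ℝ) ∈ K ∧
      lambdaMax A = p - 1 := by
  obtain ⟨B, hB, hBd, rfl⟩ := hp.1
  refine ⟨B - 1, mem_dualCone_polyAdjCone.2 ⟨?_, fun i => ?_⟩, ?_, ?_⟩
  · rw [compl_compl, compl_compl, sub_eq_add_neg]
    refine (polyAdjConvexCone P Q).add_mem hB.1 ?_
    rw [← Matrix.diagonal_one, Matrix.diagonal_neg]
    exact diagonal_mem_polyAdjCone P Q _
  · simpa [sub_eq_zero] using congrFun hBd i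
  · rw [neg_one_smul, sub_neg_eq_add, sub_add_cancel]
    exact hB.2
  · have h := lambdaMax_smul_add_smul_one hB.1.1 zero_le_one (-1)
    rw [one_smul, neg_one_smul, ← sub_eq_add_neg] at h
    rw [h]; ring

/-- Hoffman's bound is tight for the eigenvalue problem over the positive semidefinite matrices of
an adjacency cone. -/
theorem isGreatest_one_sub_lambdaMax_div_lambdaMin {P Q : SimpleGraph V} {p : ℝ}
    (hp : IsGreatest {r : ℝ | ∃ B ∈ polyAdjConvexCone P Q ⊓ psdConvexCone V,
      B.diag = 1 ∧ r = lambdaMax B} p) :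
    IsGreatest {r : ℝ | ∃ A ∈ dualCone (polyAdjCone Qᶜ Pᶜ),
      r = 1 - iverson (A ≠ 0) * (lambdaMax A / lambdaMin A)} p := by
  have hp1 : 1 ≤ p := one_le_of_isGreatest_lambdaMax Matrix.PosSemidef.one hp
  have hle : ∀ A ∈ dualCone (polyAdjCone Qᶜ Pᶜ),
      1 - iverson (A ≠ 0) * (lambdaMax A / lambdaMin A) ≤ p := by
    intro A hA
    obtain ⟨hAP, hd⟩ := mem_dualCone_polyAdjCone.1 hA
    rw [compl_compl, compl_compl] at hAP
    by_cases hA0 : A = 0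
    · rw [iverson_mul_of_not (not_not.2 hA0), sub_zero]; exact hp1
    · rw [iverson_mul_of_pos hA0]
      exact one_sub_lambdaMax_div_le hp hAP hd (lambdaMin_neg hA.1 hd hA0)
        (posSemidef_sub_smul_one hA.1 (isLeast_lambdaMin hA.1).2)
  refine ⟨?_, fun r ⟨A, hA, hr⟩ => hr ▸ hle A hA⟩
  obtain ⟨A, hA, hAK, hAp⟩ := exists_mem_dualCone_lambdaMax_add_one hp
  refine ⟨A, hA, le_antisymm ?_ (hle A hA)⟩
  have hd := (mem_dualCone_polyAdjCone.1 hA).2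
  by_cases hA0 : A = 0
  · rw [iverson_mul_of_not (not_not.2 hA0), sub_zero]
    have h0 : lambdaMax (0 : Matrix V V ℝ) = 0 := by
      have := lambdaMax_smul_add_smul_one (V := V) Matrix.isSymm_zero le_rfl (0 : ℝ)
      simpa using this
    rw [hA0, h0] at hAp
    linarith
  · rw [iverson_mul_of_pos hA0, hAp]
    have h1 := lambdaMin_neg hA.1 hd hA0
    have h2 := le_lambdaMin hA.1 hAK
    have h3 : (p - 1) / lambdaMin A ≤ -(p - 1) := by
      rw [div_le_iff_of_neg h1]
      nlinarith
    linarith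

/-- The variant of Hoffman's bound in which the smallest eigenvalue is replaced by a shift into a
cone `K` of positive semidefinite matrices. -/
theorem isGreatest_one_sub_lambdaMax_div_shift {P Q : SimpleGraph V}
    {K : ConvexCone ℝ (Matrix V V ℝ)} (hK : 1 ∈ K) {p : ℝ}
    (hp : IsGreatest {r : ℝ | ∃ B ∈ polyAdjConvexCone P Q ⊓ K, B.diag = 1 ∧ r = lambdaMax B} p) :
    IsGreatest {r : ℝ | ∃ A ∈ dualCone (polyAdjCone Qᶜ Pᶜ), ∃ μ : ℝ, μ ≤ 0 ∧
      ConeGE K A (μ • (1 : Matrix V V ℝ)) ∧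
      r = 1 - iverson (μ ≠ 0) * (lambdaMax A / μ)} p := by
  have hp1 : 1 ≤ p := one_le_of_isGreatest_lambdaMax hK hp
  constructor
  · obtain ⟨A, hA, hAK, hAp⟩ := exists_mem_dualCone_lambdaMax_add_one hp
    refine ⟨A, hA, -1, by norm_num, hAK, ?_⟩
    rw [iverson_mul_of_pos (by norm_num), hAp]
    ring
  · rintro r ⟨A, hA, μ, hμ, hAK, rfl⟩
    obtain ⟨hAP, hd⟩ := mem_dualCone_polyAdjCone.1 hA
    rw [compl_compl, compl_compl] at hAP
    rcases hμ.eq_or_lt with h0 | hneg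
    · rw [iverson_mul_of_not (not_not.2 h0), sub_zero]; exact hp1
    · rw [iverson_mul_of_pos hneg.ne]
      exact one_sub_lambdaMax_div_le hp hAP hd hneg hAK

end HoffmanBounds

section StableSets

variable {V : Type*} [Fintype V] [DecidableEq V]

open Classical in
/-- The sum of the identity and the adjacency matrix. -/
noncomputable def reflAdjMatrix (H : SimpleGraph V) : Matrix V V ℝ :=
  fun i j => if i = j ∨ H.Adj i j then 1 else 0

omit [Fintype V] in
theorem isSymm_reflAdjMatrix (H : SimpleGraph V) : (reflAdjMatrix H).IsSymm := by
  ext i j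
  have h : (j = i ∨ H.Adj j i) ↔ (i = j ∨ H.Adj i j) := by rw [eq_comm, H.adj_comm]
  simp only [Matrix.transpose_apply, reflAdjMatrix]
  split_ifs <;> first | rfl | (exfalso; tauto)

/-- The quadratic form of a symmetric matrix changes affinely when weight is moved between two
indices at which it is constant on the corresponding `2 × 2` block. -/
theorem quadForm_add_smul_single_sub {W : Matrix V V ℝ} (hW : W.IsSymm) {i j : V}
    (h : W i i + W j j = 2 * W i j) (x : V → ℝ) (t : ℝ) :
    (x + t • (Pi.single i 1 - Pi.single j 1)) ⬝ᵥ W *ᵥ (x + t • (Pi.single i 1 - Pi.single j 1)) =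
      x ⬝ᵥ W *ᵥ x + 2 * t * ((W *ᵥ x) i - (W *ᵥ x) j) := by
  set d : V → ℝ := Pi.single i 1 - Pi.single j 1 with hd
  have hxd : x ⬝ᵥ W *ᵥ d = d ⬝ᵥ W *ᵥ x := by
    rw [dotProduct_mulVec, ← mulVec_transpose, hW.eq, dotProduct_comm]
  have hdx : d ⬝ᵥ W *ᵥ x = (W *ᵥ x) i - (W *ᵥ x) j := by
    rw [hd, sub_dotProduct, single_one_dotProduct, single_one_dotProduct]
  have hdd : d ⬝ᵥ W *ᵥ d = 0 := by
    rw [hd, Matrix.mulVec_sub, sub_dotProduct, dotProduct_sub, dotProduct_sub]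
    simp only [single_one_dotProduct, mulVec_single_one, col_apply]
    rw [hW.apply i j]
    linarith
  simp only [Matrix.mulVec_add, Matrix.mulVec_smul, add_dotProduct, dotProduct_add,
    smul_dotProduct, dotProduct_smul, smul_eq_mul, hxd, hdd, hdx]
  ring

/-- **Motzkin–Straus inequality**. -/
theorem sq_sum_le_mul_quadForm_reflAdjMatrix (H : SimpleGraph V) {c : ℝ}
    (hc : ∀ S : Finset V, H.IsIndepSet S → (S.card : ℝ) ≤ c) :
    ∀ x : V → ℝ, (∀ i, 0 ≤ x i) → (∑ i, x i) ^ 2 ≤ c * (x ⬝ᵥ reflAdjMatrix H *ᵥ x) := by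
  have hc0 : 0 ≤ c := by simpa using hc ∅ (by simp [SimpleGraph.IsIndepSet])
  suffices h : ∀ n : ℕ, ∀ x : V → ℝ, (∀ i, 0 ≤ x i) →
      (Finset.univ.filter fun i => x i ≠ 0).card = n →
      (∑ i, x i) ^ 2 ≤ c * (x ⬝ᵥ reflAdjMatrix H *ᵥ x) from fun x hx => h _ x hx rfl
  intro n
  induction n using Nat.strong_induction_on with
  | _ n ih =>
  intro x hx hn
  set S : Finset V := Finset.univ.filter fun i => x i ≠ 0 with hS
  by_cases hind : H.IsIndepSet S
  · have h1 : ∑ i, x i = ∑ i ∈ S, x i := by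
      rw [hS, Finset.sum_filter_ne_zero]
    have h2 : (∑ i ∈ S, x i) ^ 2 ≤ S.card * ∑ i ∈ S, x i ^ 2 := sq_sum_le_card_mul_sum_sq
    have h3 : ∑ i ∈ S, x i ^ 2 ≤ x ⬝ᵥ reflAdjMatrix H *ᵥ x := by
      rw [quadForm_eq_sum]
      refine (Finset.sum_le_sum_of_subset_of_nonneg (Finset.subset_univ S)
        fun i _ _ => sq_nonneg (x i)).trans (Finset.sum_le_sum fun i _ => ?_)
      refine le_trans (le_of_eq ?_) (Finset.single_le_sum (fun j _ => ?_) (Finset.mem_univ i))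
      · simp [reflAdjMatrix, sq]
      · refine mul_nonneg (mul_nonneg (hx i) ?_) (hx j)
        simp only [reflAdjMatrix]
        split_ifs <;> norm_num
    rw [h1]
    calc (∑ i ∈ S, x i) ^ 2 ≤ S.card * ∑ i ∈ S, x i ^ 2 := h2
      _ ≤ c * (x ⬝ᵥ reflAdjMatrix H *ᵥ x) :=
        mul_le_mul (hc S hind) h3 (Finset.sum_nonneg fun i _ => sq_nonneg _) hc0
  · obtain ⟨i, j, hij, hi, hj, hle⟩ : ∃ i j, H.Adj i j ∧ x i ≠ 0 ∧ x j ≠ 0 ∧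
        (reflAdjMatrix H *ᵥ x) i ≤ (reflAdjMatrix H *ᵥ x) j := by
      simp only [SimpleGraph.IsIndepSet, Set.Pairwise] at hind
      push Not at hind
      obtain ⟨i, hi, j, hj, -, hij⟩ := hind
      have hi' : x i ≠ 0 := by simpa [hS] using hi
      have hj' : x j ≠ 0 := by simpa [hS] using hj
      rcases le_total ((reflAdjMatrix H *ᵥ x) i) ((reflAdjMatrix H *ᵥ x) j) with h | h
      · exact ⟨i, j, hij, hi', hj', h⟩
      · exact ⟨j, i, hij.symm, hj', hi', h⟩
    set y : V → ℝ := x + x j • (Pi.single i 1 - Pi.single j 1) with hy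
    have hne : i ≠ j := hij.ne
    have hyj : y j = 0 := by simp [hy, hne.symm]
    have hyi : y i = x i + x j := by simp [hy, hne]
    have hyk : ∀ k, k ≠ i → k ≠ j → y k = x k := fun k h1 h2 => by simp [hy, h1, h2]
    have hy0 : ∀ k, 0 ≤ y k := fun k => by
      by_cases h1 : k = i
      · rw [h1, hyi]; exact add_nonneg (hx i) (hx j)
      by_cases h2 : k = j
      · rw [h2, hyj]
      rw [hyk k h1 h2]; exact hx k
    have hcard : (Finset.univ.filter fun k => y k ≠ 0).card < n := by
      rw [← hn]
      refine Finset.card_lt_card (Finset.ssubset_iff_of_subset (fun k hk => ?_) |>.2 ⟨j, ?_, ?_⟩)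
      · simp only [hS, Finset.mem_filter, Finset.mem_univ, true_and] at hk ⊢
        by_cases h1 : k = i
        · rwa [h1]
        by_cases h2 : k = j
        · rwa [h2]
        rwa [hyk k h1 h2] at hk
      · simpa [hS] using hj
      · simpa using hyj
    have hsum : ∑ k, y k = ∑ k, x k := by
      simp [hy, Finset.sum_add_distrib, ← Finset.mul_sum]
    have hq := quadForm_add_smul_single_sub (isSymm_reflAdjMatrix H) (i := i) (j := j)
      (by simp [reflAdjMatrix, hij]; norm_num) x (x j)
    have h := ih _ hcard y hy0 rfl
    rw [hsum] at h
    refine h.trans (mul_le_mul_of_nonneg_left ?_ hc0)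
    rw [hy, hq]
    nlinarith [hx j]

/-- The trace-one problem over the completely positive matrices that vanish on the edges of `H`
has the stability number of `H` as its value. -/
theorem isGreatest_linValues_STAB {H : SimpleGraph V} {p : ℝ}
    (hp : IsGreatest {r : ℝ | ∃ X ∈ polyAdjConvexCone H H ⊓ dualConvexCone (Copositive V),
      X.trace = 1 ∧ r = (1 : V → ℝ) ⬝ᵥ X *ᵥ 1} p) :
    IsGreatest (linValues (STAB H) 1) p := by
  classical
  obtain ⟨S, hSmem, hSmax⟩ := Finset.exists_max_image
    (Finset.univ.filter fun S : Finset V => H.IsIndepSet S) Finset.card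
    ⟨∅, by simp [SimpleGraph.IsIndepSet]⟩
  have hS : H.IsIndepSet S := (Finset.mem_filter.1 hSmem).2
  have hmax : ∀ T : Finset V, H.IsIndepSet T → (T.card : ℝ) ≤ S.card := fun T hT => by
    exact_mod_cast hSmax T (Finset.mem_filter.2 ⟨Finset.mem_univ T, hT⟩)
  have hpS : p = S.card := by
    obtain ⟨X, hX, htr, hpX⟩ := hp.1
    apply le_antisymm
    · have hcop : (S.card : ℝ) • reflAdjMatrix H - vecMulVec 1 1 ∈ Copositive V := by
        refine ⟨((isSymm_reflAdjMatrix H).smul _).sub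
          (posSemidef_iff_quadForm.1 (posSemidef_vecMulVec 1)).1, fun x hx => ?_⟩
        have h1 : x ⬝ᵥ vecMulVec 1 1 *ᵥ x = (∑ i, x i) ^ 2 := by
          rw [quadForm_eq_sum, sq, Finset.sum_mul_sum]
          simp [vecMulVec_apply]
        rw [Matrix.sub_mulVec, dotProduct_sub, quadForm_smul, h1, sub_nonneg]
        exact sq_sum_le_mul_quadForm_reflAdjMatrix H hmax x hx
      have h := hX.2.2 _ hcop
      have h2 : (reflAdjMatrix H * Xᵀ).trace = 1 := by
        rw [trace_mul_transpose_eq_sum, ← htr]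
        refine Finset.sum_congr rfl fun i _ => ?_
        rw [Finset.sum_eq_single i]
        · simp [reflAdjMatrix]
        · intro j _ hji
          by_cases hadj : H.Adj i j
          · rw [le_antisymm (hX.1.2.2 i j hadj) (hX.1.2.1 i j hadj), mul_zero]
          · simp [reflAdjMatrix, hadj, hji.symm]
        · simp
      rw [Matrix.sub_mul, trace_sub, trace_vecMulVec_mul_transpose, Matrix.smul_mul, trace_smul, h2,
        smul_eq_mul, mul_one, ← hpX] at h
      linarith
    · rcases S.eq_empty_or_nonempty with h0 | hne
      · rw [h0, hpX, Finset.card_empty, Nat.cast_zero]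
        exact (posSemidef_iff_quadForm.1 (complPositive_subset_psd hX.2)).2 1
      · have hn : (0 : ℝ) < S.card := by exact_mod_cast hne.card_pos
        set v : V → ℝ := fun i => if i ∈ S then 1 else 0 with hv
        have hv0 : ∀ i, 0 ≤ v i := fun i => by simp only [hv]; split_ifs <;> norm_num
        have hsum : ∑ i, v i = S.card := by simp [hv]
        have hvz : ∀ i j, H.Adj i j → vecMulVec v v i j = 0 := fun i j hij => by
          rw [vecMulVec_apply]
          by_cases hi : i ∈ S
          · by_cases hj : j ∈ S
            · exact absurd hij (hS hi hj hij.ne)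
            · simp [hv, hj]
          · simp [hv, hi]
        have hvm : vecMulVec v v ∈ polyAdjConvexCone H H ⊓ dualConvexCone (Copositive V) :=
          ⟨⟨(vecMulVec_mem_complPositive hv0).1, fun i j h => (hvz i j h).ge,
            fun i j h => (hvz i j h).le⟩, vecMulVec_mem_complPositive hv0⟩
        refine hp.2 ⟨(S.card : ℝ)⁻¹ • vecMulVec v v, ConvexCone.smul_mem _ (inv_pos.2 hn) hvm,
          ?_, ?_⟩
        · have : (vecMulVec v v).trace = S.card := by
            rw [← hsum]
            refine Finset.sum_congr rfl fun i _ => ?_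
            simp [vecMulVec_apply, hv]
          rw [trace_smul, this, smul_eq_mul, inv_mul_cancel₀ hn.ne']
        · have : (1 : V → ℝ) ⬝ᵥ vecMulVec v v *ᵥ 1 = S.card * S.card := by
            rw [quadForm_eq_sum, ← hsum, Finset.sum_mul_sum]
            simp [vecMulVec_apply]
          rw [quadForm_smul, this]
          field_simp
  rw [hpS]
  have hval : ∀ T : Finset V, (1 : V → ℝ) ⬝ᵥ (T : Set V).indicator 1 = T.card := fun T => by
    simp [one_dotProduct, Set.indicator_apply]
  constructor
  · exact ⟨(S : Set V).indicator 1, subset_convexHull ℝ _ ⟨S, hS, rfl⟩, hval S⟩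
  · rintro _ ⟨x, hx, rfl⟩
    refine convexHull_min (t := {x : V → ℝ | 1 ⬝ᵥ x ≤ (S.card : ℝ)}) ?_ ?_ hx
    · rintro _ ⟨T, hT, rfl⟩
      have h := hmax T.toFinset (by simpa using hT)
      rw [← hval, Set.coe_toFinset] at h
      exact h
    · exact convex_halfSpace_le ⟨fun x y => dotProduct_add 1 x y,
        fun c x => dotProduct_smul c 1 x⟩ _

end StableSets

end HoffmanTheta

open HoffmanTheta in
theorem mainTheorem10 {V : Type*} [Fintype V] [DecidableEq V] [Nonempty V] :
    (∀ M : ConvexCone ℝ (Matrix V V ℝ),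
      (M : Set (Matrix V V ℝ)) ⊆ Sym V →
      IsClosed (M : Set (Matrix V V ℝ)) →
      DiagScalingInvariant (M : Set (Matrix V V ℝ)) →
      (∀ X ∈ M, ∀ i, 0 ≤ X i i) →
      (∀ X ∈ M, ∀ i, X i i = 0 → ∀ j, X j i = 0) →
      IsCompact {X : Matrix V V ℝ | X ∈ M ∧ X.trace = 1} →
      (∀ d : V → ℝ, (∀ i, 0 ≤ d i) → Matrix.diagonal d ∈ M) →
      ((∀ h : V → ℝ, ∀ X ∈ M, diagScale h X ∈ M) ∨
        (M : Set (Matrix V V ℝ)) ⊆ SymNonneg V) →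
      ∀ w : V → ℝ, (∀ i, 0 ≤ w i) →
      ∃ m : ℝ,
        IsGreatest {r : ℝ | ∃ B ∈ M, B.diag = w ∧ r = lambdaMax B} m ∧
        IsGreatest {r : ℝ | ∃ X ∈ M, X.trace = 1 ∧
          r = (fun i => √(w i)) ⬝ᵥ X *ᵥ (fun i => √(w i))} m) ∧
    (∀ G : SimpleGraph V,
      (IsGreatest (linValues (thetaRegion (coneTheta Gᶜ) (Psd V)) 1) (lovaszTheta Gᶜ 1) ∧
        IsGreatest {r : ℝ | ∃ A ∈ dualCone (polyAdjCone G G),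
          r = 1 - iverson (A ≠ 0) * (lambdaMax A / lambdaMin A)} (lovaszTheta Gᶜ 1)) ∧
      (IsGreatest (linValues (thetaRegion (coneTheta' Gᶜ) (Psd V)) 1) (lovaszTheta' Gᶜ 1) ∧
        IsGreatest {r : ℝ | ∃ A ∈ dualCone (polyAdjCone G ⊥),
          r = 1 - iverson (A ≠ 0) * (lambdaMax A / lambdaMin A)} (lovaszTheta' Gᶜ 1)) ∧
      (IsGreatest (linValues (STAB Gᶜ) 1) (alpha Gᶜ 1) ∧
        IsGreatest {r : ℝ | ∃ A ∈ dualCone (polyAdjCone G G), ∃ μ : ℝ, μ ≤ 0 ∧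
          ConeGE (ComplPositive V) A (μ • (1 : Matrix V V ℝ)) ∧
          r = 1 - iverson (μ ≠ 0) * (lambdaMax A / μ)} (alpha Gᶜ 1))) := by
  refine ⟨fun M hsym _ => exists_isGreatest_lambdaMax_quadForm M hsym, fun G => ⟨?_, ?_, ?_⟩⟩
  · have hor : (∀ h : V → ℝ, ∀ X ∈ polyAdjConvexCone Gᶜ Gᶜ ⊓ psdConvexCone V,
        diagScale h X ∈ polyAdjConvexCone Gᶜ Gᶜ ⊓ psdConvexCone V) := fun h X hX =>
      ⟨diagScale_mem_polyAdjCone_self hX.1 h, diagScale_mem_psd hX.2 h⟩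
    obtain ⟨p, hp, hp'⟩ := exists_isGreatest_lambdaMax_polyAdj Gᶜ Gᶜ (psdConvexCone V) isClosed_psd
      subset_rfl (fun h _ X hX => diagScale_mem_psd hX h)
      (fun d hd => Matrix.PosSemidef.diagonal hd) (Or.inl hor)
    have hθ := isGreatest_linValues_thetaRegion (Or.inl hor) hp hp'
    have heq : lovaszTheta Gᶜ 1 = p := hθ.csSup_eq
    have hH := isGreatest_one_sub_lambdaMax_div_lambdaMin hp
    rw [compl_compl] at hH
    rw [heq]
    exact ⟨hθ, hH⟩
  · have hcone : coneTheta' Gᶜ = polyAdjCone ⊤ Gᶜ := by rw [coneTheta', sup_compl_eq_top]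
    have hor : ((polyAdjConvexCone ⊤ Gᶜ ⊓ psdConvexCone V : ConvexCone ℝ (Matrix V V ℝ)) :
        Set (Matrix V V ℝ)) ⊆ SymNonneg V := fun X hX => ⟨hX.1.1, fun i j => by
      by_cases hij : i = j
      · rw [hij]; exact Matrix.PosSemidef.diag_nonneg hX.2
      · exact hX.1.2.1 i j hij⟩
    obtain ⟨p, hp, hp'⟩ := exists_isGreatest_lambdaMax_polyAdj ⊤ Gᶜ (psdConvexCone V) isClosed_psd
      subset_rfl (fun h _ X hX => diagScale_mem_psd hX h)
      (fun d hd => Matrix.PosSemidef.diagonal hd) (Or.inr hor)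
    have hθ := isGreatest_linValues_thetaRegion (Or.inr hor) hp hp'
    rw [← hcone] at hθ
    have heq : lovaszTheta' Gᶜ 1 = p := hθ.csSup_eq
    have hH := isGreatest_one_sub_lambdaMax_div_lambdaMin hp
    rw [compl_compl, compl_top] at hH
    rw [heq]
    exact ⟨hθ, hH⟩
  · obtain ⟨p, hp, hp'⟩ := exists_isGreatest_lambdaMax_polyAdj Gᶜ Gᶜ
      (dualConvexCone (Copositive V)) (isClosed_dualCone _) complPositive_subset_psd
      (fun h hh X hX => diagScale_mem_complPositive hX hh)
      (fun d hd => diagonal_mem_complPositive hd)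
      (Or.inr fun X hX => complPositive_subset_symNonneg hX.2)
    have hα := isGreatest_linValues_STAB hp'
    have heq : alpha Gᶜ 1 = p := hα.csSup_eq
    have hone : (1 : Matrix V V ℝ) ∈ dualConvexCone (Copositive V) := by
      rw [← Matrix.diagonal_one]
      exact diagonal_mem_complPositive fun _ => zero_le_one
    have hH := isGreatest_one_sub_lambdaMax_div_shift hone hp
    rw [compl_compl] at hH
    rw [heq]
    exact ⟨hα, hH⟩
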